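/- Let $\Omega$ be a finite set with $|\Omega|=d\ge 3$, let $p$ be a prime, and let $T_d$ be the $d$-regular tree with a legal colouring $l$, i.e. a map from the set of oriented edges to $\Omega$ with $l(e)=l(\overline e)$ for every $e$, whose restriction $l_x\colon E(x)\to\Omega$ to the set $E(x)$ of edges with origin $x$ is a bijection for every vertex $x$. For $g\in\mathrm{Aut}(T_d)$ and a vertex $x$ let $\sigma(g,x)=l_{gx}\circ g\circ l_x^{-1}\in\mathrm{Sym}(\Omega)$. For $F\le\mathrm{Sym}(\Omega)$ let $\widehat F\le\mathrm{Sym}(\Omega)$ be the product of the symmetric groups of the $F$-orbits (the largest subgroup of $\mathrm{Sym}(\Omega)$ that maps every $F$-orbit to itself), and let $$\mathrm U(F)=\{g\in\mathrm{Aut}(T_d)\mid \sigma(g,x)\in F\text{ for all vertices }x\},$$ with the subspace topology of the permutation topology on $\mathrm{Aut}(T_d)$ (pointwise convergence on vertices). For $F\le F'\le\widehat F$ let $$\mathrm G(F,F')=\{g\in\mathrm U(F')\mid \sigma(g,x)\in F\text{ for all but finitely many vertices }x\},$$ with the unique group topology that makes the inclusion $\mathrm U(F)\to\mathrm G(F,F')$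 continuous and open. For a totally disconnected locally compact group $G$, a local $p$-Sylow subgroup is a maximal pro-$p$ subgroup of a compact open subgroup of $G$. The $p$-localization $G_{(p)}$ is the commensurator $\mathrm{Comm}_G(S)$ of a local $p$-Sylow subgroup $S$ of $G$, with the unique group topology that makes the inclusion $S\to\mathrm{Comm}_G(S)$ continuous and open; a different choice of $S$ changes it only by conjugation in $G$. For subgroups $\Gamma,\Lambda$ of $\mathrm{Aut}(T_d)$ carrying such topologies, $\Gamma_{(p)}=\Lambda$ means: there is a local $p$-Sylow subgroup $S$ of $\Gamma$ such that $\mathrm{Comm}_\Gamma(S)=\Lambda$ as topological groups, and for every local $p$-Sylow subgroup $S$ of $\Gamma$ there is $g\in\Gamma$ such that $x\mapsto gxg^{-1}$ is an isomorphism of topological groups from $\mathrm{Comm}_\Gamma(S)$ onto $\Lambda$. **Theorem.** Let $F\le F'\le\widehat F\le\mathrm{Sym}(\Omega)$ and let $F(p)$ be a $p$-Sylow subgroup of $F$. Assume that $F$ and $F(p)$ have the same orbits on $\Omega$, and that for every $\omega\in\Omega$ the point stabilizer $F(p)_\omega$ is self-normalizing in $F'_\omega$, i.e. $N_{F'_\omega}(F(p)_\omega)=F(p)_\omega$.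 Then $$\mathrm G(F,F')_{(p)}=\mathrm G(F(p),F').$$ In particular, if $F'=F$, then $\mathrm U(F)_{(p)}=\mathrm G(F(p),F)$. -/

import Mathlib

open Topology Filter

/-! ### Legally coloured trees, local permutations -/

/-- A legal colouring of the graph `T` by `Ω`. The darts of `T` are the oriented edges in the sense
of Serre: `e.fst` is the origin and `e.symm` is the reversed edge. -/
structure LegalColoring {V : Type*} (T : SimpleGraph V) (Ω : Type*) where
  /-- the colour of an oriented edge -/
  color : T.Dart → Ω
  color_symm : ∀ e : T.Dart, color e.symm = color e
  bijective_star : ∀ x : V,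
    Function.Bijective (fun e : {e : T.Dart // e.fst = x} => color e.1)

section Tree

variable {V Ω : Type*} {T : SimpleGraph V}

/-- The action of an automorphism on oriented edges. -/
def mapEdge (g : T ≃g T) (e : T.Dart) : T.Dart :=
  ⟨(g e.fst, g e.snd), g.map_adj_iff.2 e.adj⟩

/-- The bijection `E(x) → E(g x)` induced by an automorphism `g`. -/
def starEquiv (g : T ≃g T) (x : V) :
    {e : T.Dart // e.fst = x} ≃ {e : T.Dart // e.fst = g x} where
  toFun e := ⟨mapEdge g e.1, congrArg g e.2⟩
  invFun e := ⟨mapEdge g.symm e.1, by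
    change g.symm e.1.fst = x
    rw [e.2]; exact g.symm_apply_apply x⟩
  left_inv e := by
    apply Subtype.ext; apply SimpleGraph.Dart.ext
    simp [mapEdge]
  right_inv e := by
    apply Subtype.ext; apply SimpleGraph.Dart.ext
    simp [mapEdge]

namespace LegalColoring

variable (c : LegalColoring T Ω)

/-- The bijection `l_x : E(x) → Ω`. -/
noncomputable def star (x : V) : {e : T.Dart // e.fst = x} ≃ Ω :=
  Equiv.ofBijective _ (c.bijective_star x)

/-- The local permutation `σ(g, x) = l_{g x} ∘ g ∘ l_x⁻¹`. -/
noncomputable def localPerm (g : T ≃g T) (x : V) : Equiv.Perm Ω :=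
  (c.star x).symm.trans ((starEquiv g x).trans (c.star (g x)))

theorem localPerm_color (g : T ≃g T) (e : T.Dart) :
    c.localPerm g e.fst (c.color e) = c.color (mapEdge g e) := by
  have h : (c.star e.fst).symm (c.color e) = ⟨e, rfl⟩ := by
    rw [Equiv.symm_apply_eq]; rfl
  simp only [localPerm, Equiv.trans_apply, h]
  rfl

theorem localPerm_eq_of_forall (g : T ≃g T) (x : V) (τ : Equiv.Perm Ω)
    (h : ∀ e : T.Dart, e.fst = x → τ (c.color e) = c.color (mapEdge g e)) :
    c.localPerm g x = τ := by
  ext ω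
  obtain ⟨⟨e, rfl⟩, rfl⟩ := (c.bijective_star x).2 ω
  exact (c.localPerm_color g e).trans (h e rfl).symm

theorem localPerm_one (x : V) : c.localPerm 1 x = 1 :=
  c.localPerm_eq_of_forall 1 x 1 fun _ _ => rfl

theorem localPerm_mul (g h : T ≃g T) (x : V) :
    c.localPerm (g * h) x = c.localPerm g (h x) * c.localPerm h x := by
  apply c.localPerm_eq_of_forall
  rintro e rfl
  rw [Equiv.Perm.mul_apply, c.localPerm_color h e]
  exact c.localPerm_color g (mapEdge h e)

theorem localPerm_inv (g : T ≃g T) (x : V) :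
    c.localPerm g⁻¹ x = (c.localPerm g (g⁻¹ x))⁻¹ := by
  have h := c.localPerm_mul g g⁻¹ x
  rw [mul_inv_cancel, localPerm_one] at h
  exact (inv_eq_of_mul_eq_one_right h.symm).symm

end LegalColoring

/-! ### Burger–Mozes and Le Boudec groups -/

/-- The Burger–Mozes universal group `U(F)`. -/
def burgerMozes (c : LegalColoring T Ω) (F : Subgroup (Equiv.Perm Ω)) : Subgroup (T ≃g T) where
  carrier := {g | ∀ x : V, c.localPerm g x ∈ F}
  one_mem' x := by rw [c.localPerm_one]; exact F.one_mem
  mul_mem' {g h} hg hh x := by rw [c.localPerm_mul]; exact F.mul_mem (hg _) (hh _)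
  inv_mem' {g} hg x := by rw [c.localPerm_inv]; exact F.inv_mem (hg _)

/-- The group `G(F)` of automorphisms acting locally like `F` at all but finitely many vertices. -/
def almostBurgerMozes (c : LegalColoring T Ω) (F : Subgroup (Equiv.Perm Ω)) :
    Subgroup (T ≃g T) where
  carrier := {g | {x : V | c.localPerm g x ∉ F}.Finite}
  one_mem' := by simp [c.localPerm_one, F.one_mem]
  mul_mem' {g h} hg hh := by
    have hg' : (h ⁻¹' {x : V | c.localPerm g x ∉ F}).Finite :=
      Set.Finite.preimage h.injective.injOn hg
    refine (hh.union hg').subset fun x hx => ?_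
    by_contra hcon
    simp only [Set.mem_union, Set.mem_preimage, Set.mem_ofPred_eq, not_or, not_not] at hcon
    exact hx (by rw [c.localPerm_mul]; exact F.mul_mem hcon.2 hcon.1)
  inv_mem' {g} hg := by
    refine (Set.Finite.preimage (f := fun x => g⁻¹ x) (g⁻¹).injective.injOn hg).subset fun x hx => ?_
    intro hcon
    exact hx (by rw [c.localPerm_inv]; exact F.inv_mem hcon)

/-- The Le Boudec group `G(F, F') = G(F) ∩ U(F')`. -/
def leBoudec (c : LegalColoring T Ω) (F F' : Subgroup (Equiv.Perm Ω)) : Subgroup (T ≃g T) :=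
  almostBurgerMozes c F ⊓ burgerMozes c F'

end Tree

/-! ### Permutation groups -/

section PermGroups

variable {Ω : Type*}

/-- The largest group of permutations preserving every orbit of `F`, i.e. the product of the
symmetric groups of the `F`-orbits. -/
def orbitHull (F : Subgroup (Equiv.Perm Ω)) : Subgroup (Equiv.Perm Ω) where
  carrier := {τ | ∀ ω : Ω, τ ω ∈ MulAction.orbit F ω}
  one_mem' ω := MulAction.mem_orbit_self ω
  mul_mem' {a b} ha hb ω := by
    have h := ha (b ω)
    rwa [MulAction.orbit_eq_iff.2 (hb ω)] at h
  inv_mem' {a} ha ω := by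
    have h := ha (a⁻¹ ω)
    rw [← Equiv.Perm.mul_apply, mul_inv_cancel, Equiv.Perm.one_apply] at h
    exact MulAction.mem_orbit_symm.1 h

/-- The point stabilizer `F_ω`, as a group of permutations of `Ω`. -/
def pointStab (F : Subgroup (Equiv.Perm Ω)) (ω : Ω) : Subgroup (Equiv.Perm Ω) :=
  F ⊓ MulAction.stabilizer (Equiv.Perm Ω) ω

end PermGroups

/-! ### The group topology that makes a given subgroup open -/

section OpenExtension

variable {G : Type*} [Group G]

/-- The topology on `G` in which a set is open if and only if each of its left translates meets
`H` in an open subset of `(H, τ)`. If some group topology on `G` makes the inclusion of `(H, τ)`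
continuous and open, then it is this one (`openExtension_unique`). -/
abbrev openExtension (H : Subgroup G) (τ : TopologicalSpace H) : TopologicalSpace G :=
  ⨆ g : G, TopologicalSpace.coinduced (fun h : H => g * (h : G)) τ

theorem isOpen_openExtension {H : Subgroup G} {τ : TopologicalSpace H} {s : Set G} :
    IsOpen[openExtension H τ] s ↔ ∀ g : G, IsOpen[τ] {h : H | g * (h : G) ∈ s} := by
  unfold openExtension
  rw [isOpen_iSup_iff]
  rfl

theorem openExtension_unique (H : Subgroup G) (τ : TopologicalSpace H) (t : TopologicalSpace G)
    [IsTopologicalGroup G] (hc : Continuous[τ, t] (fun h : H => (h : G)))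
    (ho : ∀ s : Set H, IsOpen[τ] s → IsOpen ((fun h : H => (h : G)) '' s)) :
    t = openExtension H τ := by
  ext s
  rw [isOpen_openExtension]
  constructor
  · intro hs g
    exact (hs.preimage (continuous_const_mul g)).preimage hc
  · intro hs
    rw [isOpen_iff_forall_mem_open]
    intro g hg
    refine ⟨(fun x => g⁻¹ * x) ⁻¹' ((fun h : H => (h : G)) '' {h : H | g * (h : G) ∈ s}), ?_,
      (ho _ (hs g)).preimage (continuous_const_mul g⁻¹), ⟨1, by simpa using hg, by simp⟩⟩
    rintro x ⟨h, hh, hx⟩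
    have : x = g * h := by rw [show (h : G) = g⁻¹ * x from hx]; simp
    rw [this]; exact hh

theorem isOpen_image_openExtension (H : Subgroup G) (τ : TopologicalSpace H)
    [IsTopologicalGroup H] (x : G) {s : Set H} (hs : IsOpen s) :
    IsOpen[openExtension H τ] ((fun h : H => x * (h : G)) '' s) := by
  rw [isOpen_openExtension]
  intro g
  by_cases hg : x⁻¹ * g ∈ H
  · convert hs.preimage (continuous_const_mul (⟨x⁻¹ * g, hg⟩ : H)) using 1
    ext h
    constructor
    · rintro ⟨k, hk, hkh⟩
      have : (⟨x⁻¹ * g, hg⟩ : H) * h = k := by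
        apply Subtype.ext
        change x⁻¹ * g * h = k
        rw [mul_assoc, ← show x * (k : G) = g * h from hkh]; simp
      change (⟨x⁻¹ * g, hg⟩ : H) * h ∈ s
      rwa [this]
    · intro hk
      exact ⟨_, hk, by simp [mul_assoc]⟩
  · convert @isOpen_empty H τ using 1
    ext h
    simp only [Set.mem_ofPred_eq, Set.mem_image, Set.mem_empty_iff_false, iff_false, not_exists,
      not_and]
    intro k _ hk
    apply hg
    have : x⁻¹ * g = k * (h : G)⁻¹ := by
      rw [eq_mul_inv_iff_mul_eq, mul_assoc, ← hk]; simp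
    rw [this]
    exact H.mul_mem k.2 (H.inv_mem h.2)

theorem nhds_openExtension (H : Subgroup G) (τ : TopologicalSpace H)
    [IsTopologicalGroup H] (x : G) :
    @nhds G (openExtension H τ) x = Filter.map (fun h : H => x * (h : G)) (𝓝 1) := by
  let := openExtension H τ
  have hc : Continuous (fun h : H => x * (h : G)) :=
    ⟨fun s hs => isOpen_openExtension.1 hs x⟩
  have ho : IsOpenMap (fun h : H => x * (h : G)) :=
    fun s hs => isOpen_image_openExtension H τ x hs
  have := ho.map_nhds_eq hc.continuousAt (x := (1 : H))
  simpa using this.symm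

/-- If conjugation by elements of `G` is continuous near the identity of `H`, then
`openExtension H τ` is a group topology. -/
theorem isTopologicalGroup_openExtension (H : Subgroup G) (τ : TopologicalSpace H)
    [IsTopologicalGroup H]
    (hconj : ∀ g : G, ∀ s ∈ 𝓝 (1 : H), ∃ r ∈ 𝓝 (1 : H), ∀ h ∈ r, ∃ k ∈ s,
      (k : G) = g * h * g⁻¹) :
    @IsTopologicalGroup G (openExtension H τ) _ := by
  let := openExtension H τ
  have h1 : 𝓝 (1 : G) = Filter.map (fun h : H => (h : G)) (𝓝 1) := by
    simpa using nhds_openExtension H τ 1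
  refine IsTopologicalGroup.of_nhds_one ?_ ?_ ?_ ?_
  · rw [h1, Filter.prod_map_map_eq, Filter.tendsto_map'_iff]
    have : Tendsto (fun q : H × H => q.1 * q.2) (𝓝 1 ×ˢ 𝓝 1) (𝓝 1) := by
      have := (continuous_mul (M := H)).tendsto (1, 1)
      rwa [nhds_prod_eq, one_mul] at this
    exact Filter.tendsto_map.comp this
  · rw [h1, Filter.tendsto_map'_iff]
    have : Tendsto (fun q : H => q⁻¹) (𝓝 1) (𝓝 1) := by
      simpa using (continuous_inv (G := H)).tendsto 1
    exact Filter.tendsto_map.comp this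
  · intro x
    rw [h1, Filter.map_map]
    exact nhds_openExtension H τ x
  · intro g
    rw [h1, Filter.tendsto_map'_iff]
    intro s hs
    obtain ⟨r, hr, hrs⟩ := hconj g _ (Filter.mem_map.1 hs)
    refine Filter.mem_map.2 (Filter.mem_of_superset hr fun h hh => ?_)
    obtain ⟨k, hk, hkh⟩ := hrs h hh
    change g * h * g⁻¹ ∈ s
    rw [← hkh]; exact hk

theorem continuous_openExtension (H : Subgroup G) (τ : TopologicalSpace H) :
    Continuous[τ, openExtension H τ] (fun h : H => (h : G)) := by
  refine @Continuous.mk _ _ τ (openExtension H τ) _ fun s hs => ?_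
  have h := isOpen_openExtension.1 hs 1
  simp only [one_mul] at h
  exact h

end OpenExtension

/-! ### The topologies of `Aut(T)`, `U(F)` and `G(F, F')` -/

section TreeTopology

variable {V Ω : Type*} {T : SimpleGraph V}

/-- The permutation topology on `Aut(T)` for its action on the vertices: the topology of pointwise
convergence, where the vertex set is discrete. -/
abbrev autTopology (T : SimpleGraph V) : TopologicalSpace (T ≃g T) :=
  TopologicalSpace.induced (fun (g : T ≃g T) (x : V) => g x)
    (@Pi.topologicalSpace V (fun _ => V) fun _ => ⊥)

theorem continuous_autTopology {X : Type*} [TopologicalSpace X] (f : X → (T ≃g T))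
    (h : ∀ x y : V, IsOpen {a : X | f a x = y}) : Continuous[_, autTopology T] f := by
  let : TopologicalSpace V := ⊥
  have : DiscreteTopology V := ⟨rfl⟩
  refine continuous_induced_rng.2 (continuous_pi fun x => ?_)
  exact continuous_discrete_rng.2 fun y => h x y

theorem isOpen_autTopology (x y : V) : IsOpen[autTopology T] {g : T ≃g T | g x = y} := by
  let : TopologicalSpace V := ⊥
  have : DiscreteTopology V := ⟨rfl⟩
  let := autTopology T
  have : Continuous (fun g : T ≃g T => g x) :=
    (continuous_apply x).comp continuous_induced_dom
  exact (isOpen_discrete {y}).preimage this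

theorem isTopologicalGroup_aut (T : SimpleGraph V) :
    @IsTopologicalGroup (T ≃g T) (autTopology T) _ := by
  let := autTopology T
  refine @IsTopologicalGroup.mk _ _ _ ⟨?_⟩ ⟨?_⟩
  · refine continuous_autTopology _ fun x y => ?_
    have : {a : (T ≃g T) × (T ≃g T) | (a.1 * a.2) x = y} =
        ⋃ z : V, {g : T ≃g T | g z = y} ×ˢ {g : T ≃g T | g x = z} := by
      ext a; simp
    rw [this]
    exact isOpen_iUnion fun z => (isOpen_autTopology z y).prod (isOpen_autTopology x z)
  · refine continuous_autTopology _ fun x y => ?_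
    convert isOpen_autTopology (T := T) y x using 1
    ext g
    exact ⟨fun h => by rw [Set.mem_ofPred_eq, ← h]; exact g.apply_symm_apply x,
      fun h => by rw [Set.mem_ofPred_eq, ← h]; exact g.symm_apply_apply y⟩

theorem exists_finite_fixator {s : Set (T ≃g T)} (hs : s ∈ @nhds _ (autTopology T) 1) :
    ∃ A : Set V, A.Finite ∧ ∀ g : T ≃g T, (∀ x ∈ A, g x = x) → g ∈ s := by
  let : TopologicalSpace V := ⊥
  have : DiscreteTopology V := ⟨rfl⟩
  let := autTopology T
  obtain ⟨t, ht, hts⟩ := (mem_nhds_induced (fun (g : T ≃g T) (x : V) => g x) 1 s).1 hs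
  rw [nhds_pi] at ht
  obtain ⟨I, hI, u, hu, hut⟩ := Filter.mem_pi.1 ht
  refine ⟨I, hI, fun g hg => hts (hut fun x hx => ?_)⟩
  change g x ∈ u x
  rw [hg x hx]
  exact mem_of_mem_nhds (hu x)

theorem fixator_mem_nhds {A : Set V} (hA : A.Finite) :
    {g : T ≃g T | ∀ x ∈ A, g x = x} ∈ @nhds _ (autTopology T) 1 := by
  let := autTopology T
  have : {g : T ≃g T | ∀ x ∈ A, g x = x} = ⋂ x ∈ A, {g : T ≃g T | g x = x} := by
    ext; simp
  rw [this, Filter.biInter_mem hA]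
  exact fun x _ => (isOpen_autTopology x x).mem_nhds rfl

/-- `U(F)` carries the subspace topology of `Aut(T)`. -/
instance instTopologicalSpaceBurgerMozes (c : LegalColoring T Ω) (F : Subgroup (Equiv.Perm Ω)) :
    TopologicalSpace (burgerMozes c F) :=
  TopologicalSpace.induced Subtype.val (autTopology T)

instance instIsTopologicalGroupBurgerMozes (c : LegalColoring T Ω)
    (F : Subgroup (Equiv.Perm Ω)) : IsTopologicalGroup (burgerMozes c F) := by
  let := autTopology T
  have := isTopologicalGroup_aut T
  exact topologicalGroup_induced (burgerMozes c F).subtype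

/-- `U(F)` (for `F ≤ F'`) as a subgroup of `G(F, F')`. -/
def burgerMozesIn (c : LegalColoring T Ω) (F F' : Subgroup (Equiv.Perm Ω)) :
    Subgroup (leBoudec c F F') :=
  (burgerMozes c F).subgroupOf (leBoudec c F F')

/-- The topology that `U(F)`, as a subgroup of `G(F, F')`, inherits from `Aut(T)`. -/
abbrev burgerMozesInTopology (c : LegalColoring T Ω) (F F' : Subgroup (Equiv.Perm Ω)) :
    TopologicalSpace (burgerMozesIn c F F') :=
  TopologicalSpace.induced (fun h => ((h : leBoudec c F F') : T ≃g T)) (autTopology T)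

/-- `G(F, F')` carries the group topology for which the inclusion of `U(F)` (with its subspace
topology in `Aut(T)`) is continuous and open. -/
instance instTopologicalSpaceLeBoudec (c : LegalColoring T Ω) (F F' : Subgroup (Equiv.Perm Ω)) :
    TopologicalSpace (leBoudec c F F') :=
  openExtension (burgerMozesIn c F F') (burgerMozesInTopology c F F')

theorem localPerm_eq_one_of_fixes (c : LegalColoring T Ω) (h : T ≃g T) (x : V) (hx : h x = x)
    (hn : ∀ y, T.Adj x y → h y = y) : c.localPerm h x = 1 := by
  apply c.localPerm_eq_of_forall
  rintro e rfl
  have : mapEdge h e = e := by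
    apply SimpleGraph.Dart.ext
    exact Prod.ext hx (hn _ e.adj)
  rw [this]; rfl

theorem finite_neighbors [Finite Ω] (c : LegalColoring T Ω) (x : V) : {y | T.Adj x y}.Finite := by
  have : Finite {e : T.Dart // e.fst = x} := Finite.of_equiv Ω (c.star x).symm
  refine (Set.finite_range fun e : {e : T.Dart // e.fst = x} => e.1.snd).subset ?_
  intro y hy
  exact ⟨⟨⟨(x, y), hy⟩, rfl⟩, rfl⟩

instance instIsTopologicalGroupLeBoudec [Finite Ω] (c : LegalColoring T Ω)
    (F F' : Subgroup (Equiv.Perm Ω)) : IsTopologicalGroup (leBoudec c F F') := by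
  let τA := autTopology T
  have := isTopologicalGroup_aut T
  let τ := burgerMozesInTopology c F F'
  have : IsTopologicalGroup (burgerMozesIn c F F') :=
    topologicalGroup_induced ((leBoudec c F F').subtype.comp (burgerMozesIn c F F').subtype)
  refine isTopologicalGroup_openExtension _ τ fun g s hs => ?_
  obtain ⟨t, ht, hts⟩ := (mem_nhds_induced
    (fun h : burgerMozesIn c F F' => ((h : leBoudec c F F') : T ≃g T)) 1 s).1 hs
  obtain ⟨A, hA, hAt⟩ := exists_finite_fixator ht
  set γ : T ≃g T := (g : T ≃g T) with hγ
  have hsing : {x : V | c.localPerm γ x ∉ F}.Finite := g.2.1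
  set S := {x : V | c.localPerm γ x ∉ F} with hS
  let B : Set V := (γ ⁻¹' A) ∪ (S ∪ ⋃ x ∈ S, {y | T.Adj x y})
  have hB : B.Finite := (Set.Finite.preimage γ.injective.injOn hA).union
    (hsing.union (hsing.biUnion fun x _ => finite_neighbors c x))
  refine ⟨(fun h : burgerMozesIn c F F' => ((h : leBoudec c F F') : T ≃g T)) ⁻¹'
    {h : T ≃g T | ∀ x ∈ B, h x = x}, ?_, ?_⟩
  · have hcont : Continuous
        (fun h : burgerMozesIn c F F' => ((h : leBoudec c F F') : T ≃g T)) :=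
      continuous_induced_dom
    exact hcont.continuousAt (x := 1) (fixator_mem_nhds hB)
  · intro h hh
    set η : T ≃g T := ((h : leBoudec c F F') : T ≃g T) with hη
    have hηF : ∀ x, c.localPerm η x ∈ F := h.2
    have hfix : ∀ x ∈ B, η x = x := hh
    have hmem : g * (h : leBoudec c F F') * g⁻¹ ∈ burgerMozesIn c F F' := by
      change ∀ x, c.localPerm (γ * η * γ⁻¹) x ∈ F
      intro x
      rw [c.localPerm_mul, c.localPerm_mul, c.localPerm_inv]
      generalize hy : γ⁻¹ x = y
      by_cases hyS : y ∈ S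
      · have h1 : η y = y := hfix y (Or.inr (Or.inl hyS))
        have h2 : c.localPerm η y = 1 := localPerm_eq_one_of_fixes c η y h1 fun z hz =>
          hfix z (Or.inr (Or.inr (Set.mem_biUnion hyS hz)))
        rw [h1, h2, mul_one, mul_inv_cancel]
        exact F.one_mem
      · have h1 : η y ∉ S := by
          intro hcon
          have := hfix _ (Or.inr (Or.inl hcon))
          exact hyS (by rwa [η.injective this] at hcon)
        simp only [hS, Set.mem_ofPred_eq, not_not] at hyS h1
        exact F.mul_mem (F.mul_mem h1 (hηF y)) (F.inv_mem hyS)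
    refine ⟨⟨_, hmem⟩, hts (hAt _ fun x hx => ?_), rfl⟩
    change γ (η (γ⁻¹ x)) = x
    have hx' : γ (γ⁻¹ x) = x := γ.apply_symm_apply x
    rw [hfix (γ⁻¹ x) (Or.inl (by rw [Set.mem_preimage, hx']; exact hx)), hx']

end TreeTopology

/-! ### Local Sylow subgroups and prime localization -/

section Localization

variable {G : Type*} [Group G] [TopologicalSpace G]

/-- A subgroup of a topological group is pro-`p` if it is profinite for the subspace topology and
all its open normal subgroups have index a power of `p`. -/
def IsProPSubgroup (p : ℕ) (P : Subgroup G) : Prop :=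
  CompactSpace P ∧ T2Space P ∧ TotallyDisconnectedSpace P ∧
    ∀ N : Subgroup P, N.Normal → IsOpen (N : Set P) → ∃ k : ℕ, N.index = p ^ k

/-- A local `p`-Sylow subgroup: a maximal pro-`p` subgroup of a compact open subgroup. -/
def IsLocalSylow (p : ℕ) (S : Subgroup G) : Prop :=
  ∃ K : Subgroup G, IsOpen (K : Set G) ∧ IsCompact (K : Set G) ∧
    Maximal (fun P : Subgroup G => P ≤ K ∧ IsProPSubgroup p P) S

/-- The commensurator `Comm_G(S)`, as a group of its own; it carries its localized topology rather
than the subspace topology of `G`. -/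
def CommLocalization (S : Subgroup G) : Type _ := Subgroup.Commensurable.commensurator S

instance instGroupCommLocalization (S : Subgroup G) : Group (CommLocalization S) :=
  inferInstanceAs (Group (Subgroup.Commensurable.commensurator S))

/-- The inclusion of `Comm_G(S)` into `G`. -/
def CommLocalization.incl (S : Subgroup G) : CommLocalization S →* G :=
  (Subgroup.Commensurable.commensurator S).subtype

/-- `S` as a subgroup of `Comm_G(S)`. -/
def CommLocalization.base (S : Subgroup G) : Subgroup (CommLocalization S) :=
  S.comap (CommLocalization.incl S)

/-- The topology on `S`, as a subgroup of `Comm_G(S)`, inherited from `G`. -/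
abbrev CommLocalization.baseTopology (S : Subgroup G) :
    TopologicalSpace (CommLocalization.base S) :=
  TopologicalSpace.induced (fun s => CommLocalization.incl S s) inferInstance

/-- The group topology on `Comm_G(S)` for which the inclusion of `S` is continuous and open. -/
instance instTopologicalSpaceCommLocalization (S : Subgroup G) :
    TopologicalSpace (CommLocalization S) :=
  openExtension (CommLocalization.base S) (CommLocalization.baseTopology S)

open scoped Pointwise in
theorem isTopologicalGroup_commLocalization [IsTopologicalGroup G] (S : Subgroup G)
    (hS : IsClosed (S : Set G)) : IsTopologicalGroup (CommLocalization S) := by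
  let τ := CommLocalization.baseTopology S
  have : IsTopologicalGroup (CommLocalization.base S) :=
    topologicalGroup_induced
      ((CommLocalization.incl S).comp (CommLocalization.base S).subtype)
  refine isTopologicalGroup_openExtension _ τ fun g s hs => ?_
  set γ : G := CommLocalization.incl S g with hγ
  let j : CommLocalization.base S →* G :=
    (CommLocalization.incl S).comp (CommLocalization.base S).subtype
  have hj : Continuous j := continuous_induced_dom
  have hs' : s ∈ Filter.comap j (𝓝 1) := by
    have := nhds_induced j 1
    rw [map_one] at this
    rwa [← this]
  obtain ⟨t, ht, hts⟩ := Filter.mem_comap.1 hs'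
  -- the elements of `S` whose conjugate by `γ` lies in `S`
  let conj : G →* G := (MulAut.conj γ).toMonoidHom
  have hconj : Continuous conj := by
    change Continuous fun x => γ * x * γ⁻¹
    fun_prop
  let L : Subgroup (CommLocalization.base S) := S.comap (conj.comp j)
  have hLc : IsClosed (L : Set (CommLocalization.base S)) :=
    hS.preimage (hconj.comp hj)
  have hLi : L.FiniteIndex := by
    have hg : Subgroup.Commensurable (ConjAct.toConjAct γ⁻¹ • S) S :=
      (Subgroup.Commensurable.commensurator S).inv_mem g.2
    refine ⟨?_⟩
    have h1 : S.comap conj = ConjAct.toConjAct γ⁻¹ • S := by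
      ext x
      rw [Subgroup.mem_pointwise_smul_iff_inv_smul_mem, ← ConjAct.toConjAct_inv, inv_inv,
        ConjAct.toConjAct_smul]
      rfl
    have h2 : L = (S.comap conj).comap j := (Subgroup.comap_comap S conj j).symm
    rw [h2, Subgroup.index_comap, h1]
    have h3 : j.range = S := by
      ext x
      constructor
      · rintro ⟨y, rfl⟩
        exact y.2
      · intro hx
        have hxc : x ∈ Subgroup.Commensurable.commensurator S := by
          rw [Subgroup.Commensurable.commensurator_mem_iff]
          have : ConjAct.toConjAct x • S = S := Subgroup.conj_smul_eq_self_of_mem hx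
          rw [this]
        exact ⟨⟨⟨x, hxc⟩, hx⟩, rfl⟩
    rw [h3]
    exact hg.1
  have hLo : IsOpen (L : Set (CommLocalization.base S)) := L.isOpen_of_isClosed_of_finiteIndex hLc
  refine ⟨(L : Set _) ∩ (conj ∘ j) ⁻¹' t, Filter.inter_mem (hLo.mem_nhds L.one_mem) ?_, ?_⟩
  · apply (hconj.comp hj).continuousAt (x := 1)
    simpa using ht
  · rintro h ⟨hL, hht⟩
    exact ⟨⟨g * h * g⁻¹, hL⟩, hts hht, rfl⟩

end Localization

/-- For subgroups `Γ, Λ` of a group `A`, each with a topology: `Γ_(p) = Λ` as topological groups.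
The `p`-localization of `Γ` is the commensurator in `Γ` of a local `p`-Sylow subgroup with its
localized topology. It depends on the choice of that subgroup only up to conjugation in `Γ`. So the
equality says that `Λ` is the localization at some local `p`-Sylow subgroup of `Γ`, and that the
localization at any other one is carried to `Λ` by conjugation by an element of `Γ`. -/
def IsPrimeLocalization (p : ℕ) {A : Type*} [Group A] (Γ Λ : Subgroup A)
    [TopologicalSpace Γ] [TopologicalSpace Λ] : Prop :=
  (∃ S : Subgroup Γ, IsLocalSylow p S ∧
    ∃ φ : CommLocalization S ≃ₜ* Λ, ∀ x, (φ x : A) = (CommLocalization.incl S x : Γ)) ∧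
  ∀ S : Subgroup Γ, IsLocalSylow p S →
    ∃ (g : Γ) (φ : CommLocalization S ≃ₜ* Λ),
      ∀ x, (φ x : A) = (g * CommLocalization.incl S x * g⁻¹ : Γ)

/-! Write D for F(p). The candidate local Sylow subgroup is S = U(D)_x, the stabilizer of a vertex x
in U(D).

The permutation hypotheses enter through one consequence, `mem_of_conj_pointStab_le`: if a in F'
conjugates some D_ω into D, then a lies in D. Indeed F' preserves the orbits of F, which are those
of D, so a can be corrected by an element of D to fix ω. The corrected element normalizes D_ω and so
lies in it. Together with the normalizer condition in finite p-groups, this shows that D and D_ω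
cannot be enlarged to bigger p-subgroups of F and F_ω.

S is maximal pro-p in the compact open subgroup U(F)_x (`HasFixBasis.le_fixIn_of_elemProP`). Given a
larger pro-p group, one moves outwards from x. An element whose local permutations nearer to x lie
in D can be corrected by S to fix everything up to the next vertex y. Its local permutation at y
then lies in a p-subgroup of F_ω containing D_ω, hence in D_ω.

Commensurating S means preserving its germ at the identity under conjugation. Far from x, elements
of S fixing a large ball still realize all of D_ω at y, so a commensurating γ conjugates D_ω into D
by σ(γ,y), and σ(γ,y) lies in D. Conversely, conjugation by G(D,F') is continuous for the topology
in which U(D) is open, so it preserves the germ of S (`eventually_conj_mem_fixIn`).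

Any two local Sylow subgroups have conjugate germs, by profinite Sylow theory, and both the
commensurator and its topology depend only on the germ (`exists_commLocalization_equiv`). The only
topological input about Γ is the neighbourhood basis `HasFixBasis`, so U(F) and G(F,F') are treated
at once. -/

section ElementwiseProP

variable {G : Type*} [Group G] [TopologicalSpace G]

/-- Every element of `P` has `p`-power powers arbitrarily close to the identity. For compact
subgroups of a nonarchimedean Hausdorff group this is the pro-`p` property. -/
def ElemProP (p : ℕ) (P : Subgroup G) : Prop :=
  ∀ g ∈ P, ∀ U ∈ 𝓝 (1 : G), ∃ k : ℕ, g ^ p ^ k ∈ U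

theorem ElemProP.mono {p : ℕ} {P Q : Subgroup G} (hQ : ElemProP p Q) (h : P ≤ Q) :
    ElemProP p P :=
  fun g hg => hQ g (h hg)

end ElementwiseProP

/-! ### Sylow theory of profinite groups -/

section Profinite

/-- Compactness: if no member of the chain lay in U, the nested nonempty closed sets P \ U would
share a point, which would lie in the infimum but not in U. -/
theorem exists_mem_chain_le_of_sInf_le {H : Type*} [Group H] [TopologicalSpace H]
    [CompactSpace H] {c : Set (Subgroup H)} (hc : IsChain (· ≤ ·) c)
    (hne : c.Nonempty) (hcl : ∀ P ∈ c, IsClosed (P : Set H)) {U : Subgroup H}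
    (hU : IsOpen (U : Set H)) (h : sInf c ≤ U) : ∃ P ∈ c, P ≤ U := by
  have : Nonempty c := hne.to_subtype
  by_contra! hcon
  have := IsCompact.nonempty_iInter_of_directed_nonempty_isCompact_isClosed
    (fun P : c => ((P : Subgroup H) : Set H) ∩ (U : Set H)ᶜ) ?_ ?_
    (fun P => ((hcl P P.2).inter hU.isClosed_compl).isCompact)
    (fun P => (hcl P P.2).inter hU.isClosed_compl)
  · obtain ⟨x, hx⟩ := this
    simp only [Set.mem_iInter] at hx
    obtain ⟨P, hP⟩ := hne
    exact (hx ⟨P, hP⟩).2 (h (Subgroup.mem_sInf.2 fun Q hQ => (hx ⟨Q, hQ⟩).1))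
  · intro P Q
    rcases hc.total P.2 Q.2 with hPQ | hPQ
    · exact ⟨P, le_rfl, Set.inter_subset_inter_left _ hPQ⟩
    · exact ⟨Q, Set.inter_subset_inter_left _ hPQ, le_rfl⟩
  · intro P
    obtain ⟨x, hx, hxU⟩ := SetLike.not_le_iff_exists.1 (hcon P P.2)
    exact ⟨x, hx, hxU⟩

variable {H : Type*} [Group H] [TopologicalSpace H] [IsTopologicalGroup H] [CompactSpace H]
  [TotallyDisconnectedSpace H]

/-- A subgroup of a profinite group whose index is prime to `p`, as a supernatural number. -/
def PrimeToIndex {H : Type*} [Group H] [TopologicalSpace H] (p : ℕ) (P : Subgroup H) : Prop :=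
  ∀ U : Subgroup H, IsOpen (U : Set H) → P ≤ U → ¬ p ∣ U.index

/-- Zorn's lemma downwards; an open subgroup above the infimum of a chain already lies above a
member. The minimal subgroup obtained here plays the role of a Sylow subgroup. -/
theorem exists_minimal_primeToIndex {H : Type*} [Group H] [TopologicalSpace H]
    [CompactSpace H] (p : ℕ) (hp : p.Prime) :
    ∃ P : Subgroup H, Minimal (fun P : Subgroup H => IsClosed (P : Set H) ∧ PrimeToIndex p P) P := by
  refine zorn_le₀ (α := (Subgroup H)ᵒᵈ)
    {P | IsClosed ((OrderDual.ofDual P : Subgroup H) : Set H) ∧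
      PrimeToIndex p (OrderDual.ofDual P : Subgroup H)} fun c hc hchain => ?_
  rcases c.eq_empty_or_nonempty with rfl | hne
  · refine ⟨OrderDual.toDual ⊤, ⟨isClosed_univ, fun U _ hU => ?_⟩, by simp⟩
    have h : U = ⊤ := top_le_iff.1 hU
    rw [h, Subgroup.index_top]
    exact hp.one_lt.ne' ∘ Nat.dvd_one.1
  · let c' : Set (Subgroup H) := OrderDual.ofDual '' c
    have hc' : ∀ P ∈ c', IsClosed (P : Set H) ∧ PrimeToIndex p P := by
      rintro _ ⟨P, hP, rfl⟩
      exact hc hP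
    refine ⟨OrderDual.toDual (sInf c'), ⟨?_, ?_⟩, fun P hP => ?_⟩
    · change IsClosed ((sInf c' : Subgroup H) : Set H)
      rw [Subgroup.coe_sInf]
      exact isClosed_biInter fun P hP => (hc' P hP).1
    · intro U hU hle
      have hch : IsChain (· ≤ ·) c' := by
        rintro _ ⟨P, hP, rfl⟩ _ ⟨Q, hQ, rfl⟩ hne
        exact (hchain hP hQ fun h => hne (congrArg _ h)).symm
      obtain ⟨P, hP, hPU⟩ := exists_mem_chain_le_of_sInf_le hch (hne.image _)
        (fun P hP => (hc' P hP).1) hU hle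
      exact (hc' P hP).2 U hU hPU
    · have h : sInf c' ≤ OrderDual.ofDual P := sInf_le (Set.mem_image_of_mem _ hP)
      exact h

theorem exists_openNormal_le {U : Set H} (hU : U ∈ 𝓝 (1 : H)) :
    ∃ N : Subgroup H, N.Normal ∧ IsOpen (N : Set H) ∧ (N : Set H) ⊆ U := by
  obtain ⟨W, hWU, hW, h1⟩ := mem_nhds_iff.1 hU
  obtain ⟨N, hN⟩ := ProfiniteGrp.exist_openNormalSubgroup_sub_open_nhds_of_one hW h1
  exact ⟨N.toSubgroup, N.isNormal', N.isOpen', hN.trans hWU⟩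

/-- A subgroup of prime-to-`p` index in one of prime-to-`p` index has prime-to-`p` index. -/
theorem PrimeToIndex.trans {p : ℕ} (hp : p.Prime) {P : Subgroup H} (hP : PrimeToIndex p P)
    {Q : Subgroup P} (hQ : ¬ p ∣ Q.index) : PrimeToIndex p (Q.map P.subtype) := by
  intro U hU hQU hdvd
  obtain ⟨N, hN, hNo, hNU⟩ := exists_openNormal_le (U := (U : Set H)) (hU.mem_nhds U.one_mem)
  -- Indices are multiplicative in the finite quotient by N: p divides either the index of the image
  -- of Q in that of P, which divides `Q.index`, or the index of the open subgroup PN containing P.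
  let π := QuotientGroup.mk' N
  have hker : N ≤ U := hNU
  have h1 : (U.map π).index = U.index :=
    Subgroup.index_map_eq _ (QuotientGroup.mk'_surjective N) (by simpa [π] using hker)
  let Q' := (Q.map P.subtype).map π
  let P' := P.map π
  have hQP : Q' ≤ P' := Subgroup.map_mono (by rintro _ ⟨x, _, rfl⟩; exact x.2)
  have h2 : p ∣ Q'.index := by
    rw [← h1] at hdvd
    exact hdvd.trans (Subgroup.index_dvd_of_le (Subgroup.map_mono hQU))
  rw [← Subgroup.relIndex_mul_index hQP, hp.dvd_mul] at h2
  rcases h2 with h2 | h2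
  · apply hQ
    refine h2.trans ?_
    have h3 := Subgroup.index_map_dvd Q (π.subgroupMap_surjective P)
    suffices h4 : Q'.subgroupOf P' = Q.map (π.subgroupMap P) by
      rwa [← h4] at h3
    ext ⟨x, hx⟩
    simp only [Subgroup.mem_subgroupOf, Q', Subgroup.mem_map, Subtype.ext_iff]
    constructor
    · rintro ⟨_, ⟨y, hy, rfl⟩, rfl⟩
      exact ⟨y, hy, rfl⟩
    · rintro ⟨y, hy, h⟩
      exact ⟨_, ⟨y, hy, rfl⟩, h⟩
  · refine hP (P'.comap π) ?_ (Subgroup.le_comap_map _ _) ?_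
    · refine Subgroup.isOpen_mono (H₁ := N) (fun x hx => ?_) hNo
      have : π x = 1 := (QuotientGroup.eq_one_iff x).2 hx
      rw [Subgroup.mem_comap, this]
      exact P'.one_mem
    · rwa [Subgroup.index_comap_of_surjective _ (QuotientGroup.mk'_surjective N)]

/-- The preimage in P of a Sylow subgroup of the finite image P/(P ∩ N) again has prime-to-p index,
so by minimality it is all of P. Hence every finite image of P is a p-group. -/
theorem elemProP_of_minimal {p : ℕ} (hp : p.Prime) {P : Subgroup H}
    (hP : Minimal (fun P : Subgroup H => IsClosed (P : Set H) ∧ PrimeToIndex p P) P) :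
    ElemProP p P := by
  have := Fact.mk hp
  intro g hg U hU
  obtain ⟨N, hN, hNo, hNU⟩ := exists_openNormal_le hU
  have hfin : Finite (H ⧸ N) := N.quotient_finite_of_isOpen hNo
  let π := QuotientGroup.mk' N
  let f := π.subgroupMap P
  let R : Sylow p (P.map π) := default
  let Q : Subgroup P := (R : Subgroup (P.map π)).comap f
  have hQ : ¬ p ∣ Q.index := by
    rw [Subgroup.index_comap_of_surjective _ (π.subgroupMap_surjective P)]
    exact R.not_dvd_index
  have hQo : IsOpen (Q : Set P) := by
    refine Subgroup.isOpen_mono (H₁ := N.subgroupOf P) (fun x hx => ?_)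
      (hNo.preimage continuous_subtype_val)
    have : f x = 1 := Subtype.ext ((QuotientGroup.eq_one_iff (x : H)).2 hx)
    rw [Subgroup.mem_comap, this]
    exact one_mem _
  have hQcl : IsClosed ((Q.map P.subtype : Subgroup H) : Set H) := by
    rw [Subgroup.coe_map]
    exact hP.prop.1.isClosedEmbedding_subtypeVal.isClosedMap _ (Q.isClosed_of_isOpen hQo)
  have hle := hP.le_of_le ⟨hQcl, hP.prop.2.trans hp hQ⟩
    (by rintro _ ⟨x, _, rfl⟩; exact x.2)
  obtain ⟨x, hx, hxg⟩ := hle hg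
  obtain ⟨k, hk⟩ := R.isPGroup' ⟨f x, hx⟩
  refine ⟨k, hNU ?_⟩
  have h1 : (f x) ^ p ^ k = 1 := congrArg Subtype.val hk
  have h2 : π ((x : H) ^ p ^ k) = 1 := by
    rw [map_pow]
    exact congrArg Subtype.val h1
  change (x : H) = g at hxg
  rw [hxg] at h2
  exact (QuotientGroup.eq_one_iff _).1 h2

/-- Q acts on the finite set H/U through a p-group. As p does not divide its cardinality, some coset
gU is fixed. -/
theorem exists_conj_le_open {p : ℕ} (hp : p.Prime) {U Q : Subgroup H} (hU : IsOpen (U : Set H))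
    (hidx : ¬ p ∣ U.index) (hQ : ElemProP p Q) : ∃ g : H, ∀ q ∈ Q, g⁻¹ * q * g ∈ U := by
  have := Fact.mk hp
  obtain ⟨N, hN, hNo, hNU⟩ := exists_openNormal_le (U := (U : Set H)) (hU.mem_nhds U.one_mem)
  let φ : Q →* Equiv.Perm (H ⧸ U) := (MulAction.toPermHom H (H ⧸ U)).comp Q.subtype
  have hφ : IsPGroup p φ.range := by
    rintro ⟨_, q, rfl⟩
    obtain ⟨k, hk⟩ := hQ q q.2 N (hNo.mem_nhds N.one_mem)
    refine ⟨k, Subtype.ext ?_⟩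
    change φ q ^ p ^ k = 1
    rw [← map_pow]
    ext x
    obtain ⟨h, rfl⟩ := QuotientGroup.mk_surjective x
    change (QuotientGroup.mk ((q : H) ^ p ^ k * h) : H ⧸ U) = QuotientGroup.mk h
    refine (QuotientGroup.eq.2 (hNU ?_)).symm
    have := hN.conj_mem _ hk h⁻¹
    rwa [inv_inv, mul_assoc] at this
  obtain ⟨x, hx⟩ := hφ.nonempty_fixed_point_of_prime_not_dvd_card (H ⧸ U) hidx
  obtain ⟨g, rfl⟩ := QuotientGroup.mk_surjective x
  refine ⟨g, fun q hq => ?_⟩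
  have h := hx ⟨φ ⟨q, hq⟩, ⟨q, hq⟩, rfl⟩
  change (QuotientGroup.mk (q * g) : H ⧸ U) = QuotientGroup.mk g at h
  have := QuotientGroup.eq.1 h.symm
  rwa [← mul_assoc] at this

/-- P is the intersection of the open subgroups containing it. The conjugators for each of these
form a directed family of nonempty closed sets, which meet by compactness. -/
theorem exists_conj_le {p : ℕ} (hp : p.Prime) {P Q : Subgroup H} (hPc : IsClosed (P : Set H))
    (hP : PrimeToIndex p P) (hQ : ElemProP p Q) : ∃ g : H, ∀ q ∈ Q, g⁻¹ * q * g ∈ P := by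
  let I := {U : Subgroup H // IsOpen (U : Set H) ∧ P ≤ U}
  have : Nonempty I := ⟨⊤, isOpen_univ, le_top⟩
  let t : I → Set H := fun U => {g | ∀ q ∈ Q, g⁻¹ * q * g ∈ U.1}
  have hcl : ∀ U, IsClosed (t U) := by
    intro U
    simp only [t, Set.ofPred_forall]
    refine isClosed_biInter fun q _ => ?_
    exact (U.1.isClosed_of_isOpen U.2.1).preimage
      (f := fun g : H => g⁻¹ * q * g) (by fun_prop)
  obtain ⟨g, hg⟩ := IsCompact.nonempty_iInter_of_directed_nonempty_isCompact_isClosed t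
    (fun U V => ⟨⟨U.1 ⊓ V.1, U.2.1.inter V.2.1, le_inf U.2.2 V.2.2⟩,
      fun g hg q hq => (hg q hq).1, fun g hg q hq => (hg q hq).2⟩)
    (fun U => exists_conj_le_open hp U.2.1 (hP U.1 U.2.1 U.2.2) hQ)
    (fun U => (hcl U).isCompact) hcl
  refine ⟨g, fun q hq => ?_⟩
  have h := ProfiniteGrp.closedSubgroup_eq_sInf_open (⟨P, hPc⟩ : ClosedSubgroup H)
  change P = _ at h
  rw [h, Subgroup.mem_sInf]
  exact fun U hU => Set.mem_iInter.1 hg ⟨U, hU⟩ q hq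

end Profinite

/-! ### Local Sylow subgroups -/

section LocalSylow

theorem eventually_conj {G : Type*} [Group G] [TopologicalSpace G] [IsTopologicalGroup G]
    {q : G → Prop} (h : ∀ᶠ x in 𝓝 (1 : G), q x) (u : G) :
    ∀ᶠ x in 𝓝 (1 : G), q (u⁻¹ * x * u) := by
  have hc : Tendsto (fun x : G => u⁻¹ * x * u) (𝓝 1) (𝓝 1) := by
    have : Continuous fun x : G => u⁻¹ * x * u := by fun_prop
    simpa using this.tendsto 1
  exact hc.eventually h

/-- The conjugate `g P g⁻¹`. -/
def conjBy {G : Type*} [Group G] (g : G) (P : Subgroup G) : Subgroup G :=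
  P.comap (MulAut.conj g⁻¹).toMonoidHom

theorem mem_conjBy {G : Type*} [Group G] {g x : G} {P : Subgroup G} :
    x ∈ conjBy g P ↔ g⁻¹ * x * g ∈ P := by
  change g⁻¹ * x * g⁻¹⁻¹ ∈ P ↔ _
  rw [inv_inv]

theorem conjBy_le {G : Type*} [Group G] {g : G} {K P : Subgroup G} (hP : P ≤ K) (hg : g ∈ K) :
    conjBy g P ≤ K := by
  intro x hx
  have := hP (mem_conjBy.1 hx)
  rwa [K.mul_mem_cancel_right hg, K.mul_mem_cancel_left (K.inv_mem hg)] at this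

theorem isClosed_conjBy {G : Type*} [Group G] [TopologicalSpace G] [IsTopologicalGroup G]
    {P : Subgroup G} (hP : IsClosed (P : Set G)) (g : G) :
    IsClosed (conjBy g P : Set G) := by
  have : (conjBy g P : Set G) = (fun x => g⁻¹ * x * g) ⁻¹' P := by
    ext x
    exact mem_conjBy
  rw [this]
  exact hP.preimage (by fun_prop)

theorem ElemProP.conjBy {G : Type*} [Group G] [TopologicalSpace G] [IsTopologicalGroup G] {p : ℕ}
    {P : Subgroup G} (hP : ElemProP p P) (g : G) : ElemProP p (conjBy g P) := by
  intro x hx U hU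
  obtain ⟨k, hk⟩ := hP _ (mem_conjBy.1 hx) _ (eventually_conj (q := (· ∈ U)) hU g⁻¹)
  refine ⟨k, ?_⟩
  have h : (g⁻¹ * x * g) ^ p ^ k = g⁻¹ * x ^ p ^ k * g := by
    simpa using conj_pow (i := p ^ k) (a := g⁻¹) (b := x)
  rw [Set.mem_ofPred_eq, h] at hk
  convert hk using 1
  group

/-- `P` is a closed (elementwise) pro-`p` subgroup of `K` into which every such subgroup of `K`
can be conjugated. -/
structure DominatesProP {G : Type*} [Group G] [TopologicalSpace G] (p : ℕ) (K P : Subgroup G) :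
    Prop where
  le : P ≤ K
  isClosed : IsClosed (P : Set G)
  elemProP : ElemProP p P
  exists_conj : ∀ Q ≤ K, ElemProP p Q → ∃ g ∈ K, ∀ q ∈ Q, g⁻¹ * q * g ∈ P

theorem isOpen_subgroup_of_eventually {G : Type*} [Group G] [TopologicalSpace G]
    [IsTopologicalGroup G] {A B : Subgroup G} (h : ∀ᶠ x in 𝓝 (1 : G), x ∈ B → x ∈ A) :
    IsOpen (A.subgroupOf B : Set B) := by
  apply Subgroup.isOpen_of_mem_nhds _ (g := 1)
  have : Tendsto (fun x : B => (x : G)) (𝓝 1) (𝓝 1) := continuous_subtype_val.tendsto 1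
  filter_upwards [this.eventually h] with x hx
  exact hx x.2

/-- In a compact group a closed subgroup has finite index exactly when it is open, so
commensurability is equality of germs at the identity. -/
theorem commensurable_iff_eventually {G : Type*} [Group G] [TopologicalSpace G]
    [IsTopologicalGroup G] [T2Space G] {A B : Subgroup G} (hA : IsCompact (A : Set G))
    (hB : IsCompact (B : Set G)) :
    Subgroup.Commensurable A B ↔ ∀ᶠ x in 𝓝 (1 : G), (x ∈ A ↔ x ∈ B) := by
  have key : ∀ {A B : Subgroup G}, IsCompact (A : Set G) → IsCompact (B : Set G) →
      (A.relIndex B ≠ 0 ↔ ∀ᶠ x in 𝓝 (1 : G), x ∈ B → x ∈ A) := by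
    intro A B hA hB
    have : CompactSpace B := isCompact_iff_compactSpace.1 hB
    constructor
    · intro h
      have : (A.subgroupOf B).FiniteIndex := ⟨h⟩
      have ho := (A.subgroupOf B).isOpen_of_isClosed_of_finiteIndex
        (hA.isClosed.preimage continuous_subtype_val)
      have h1 := ho.mem_nhds (one_mem _)
      rw [nhds_induced] at h1
      obtain ⟨t, ht, hts⟩ := Filter.mem_comap.1 h1
      filter_upwards [ht] with x hx hxB
      exact hts (show (⟨x, hxB⟩ : B) ∈ Subtype.val ⁻¹' t from hx)
    · intro h
      have := (A.subgroupOf B).quotient_finite_of_isOpen (isOpen_subgroup_of_eventually h)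
      exact Subgroup.index_ne_zero_of_finite
  rw [Subgroup.Commensurable, key hA hB, key hB hA, ← Filter.eventually_and]
  exact Filter.eventually_congr (Filter.Eventually.of_forall fun x => by tauto)

theorem mem_commensurator_iff_eventually {G : Type*} [Group G] [TopologicalSpace G]
    [IsTopologicalGroup G] [T2Space G] {S : Subgroup G} (hS : IsCompact (S : Set G)) (γ : G) :
    γ ∈ Subgroup.Commensurable.commensurator S ↔
      ∀ᶠ x in 𝓝 (1 : G), (γ⁻¹ * x * γ ∈ S ↔ x ∈ S) := by
  open scoped Pointwise in
  have h1 : ConjAct.toConjAct γ • S = conjBy γ S := by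
    ext x
    rw [Subgroup.mem_pointwise_smul_iff_inv_smul_mem, ← ConjAct.toConjAct_inv,
      ConjAct.toConjAct_smul]
    rfl
  have h2 : IsCompact (conjBy γ S : Set G) := by
    have : (conjBy γ S : Set G) = (fun x => γ * x * γ⁻¹) '' S := by
      ext x
      rw [SetLike.mem_coe, mem_conjBy]
      constructor
      · exact fun h => ⟨_, h, by group⟩
      · rintro ⟨y, hy, rfl⟩
        convert SetLike.mem_coe.1 hy using 1
        group
    rw [this]
    exact hS.image (by fun_prop)
  rw [Subgroup.Commensurable.commensurator_mem_iff, h1, commensurable_iff_eventually h2 hS]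
  simp only [mem_conjBy]

variable {G : Type*} [Group G] [TopologicalSpace G] [NonarchimedeanGroup G] [T2Space G]

theorem isProPSubgroup_iff {p : ℕ} (hp : p.Prime) {P : Subgroup G} :
    IsProPSubgroup p P ↔ IsCompact (P : Set G) ∧ ElemProP p P := by
  have := Fact.mk hp
  constructor
  · rintro ⟨h1, h2, h3, h4⟩
    refine ⟨isCompact_iff_compactSpace.2 h1, fun g hg U hU => ?_⟩
    obtain ⟨N, hN, hNo, hNU⟩ := exists_openNormal_le (H := P) (U := Subtype.val ⁻¹' U)
      (continuous_subtype_val.continuousAt.preimage_mem_nhds hU)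
    obtain ⟨k, hk⟩ := h4 N hN hNo
    refine ⟨k, ?_⟩
    have := N.pow_index_mem (⟨g, hg⟩ : P)
    rw [hk] at this
    exact hNU this
  · rintro ⟨h1, h2⟩
    have := isCompact_iff_compactSpace.1 h1
    refine ⟨this, inferInstance, inferInstance, fun N hN hNo => ?_⟩
    have := N.quotient_finite_of_isOpen hNo
    have hq : IsPGroup p (P ⧸ N) := by
      intro x
      obtain ⟨g, rfl⟩ := QuotientGroup.mk_surjective x
      have h3 := hNo.mem_nhds N.one_mem
      rw [nhds_induced] at h3
      obtain ⟨t, ht, hts⟩ := Filter.mem_comap.1 h3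
      obtain ⟨k, hk⟩ := h2 g g.2 t ht
      exact ⟨k, (QuotientGroup.eq_one_iff (g ^ p ^ k)).2 (hts hk)⟩
    exact IsPGroup.iff_card.1 hq

theorem exists_dominatesProP {p : ℕ} (hp : p.Prime) {K : Subgroup G}
    (hK : IsCompact (K : Set G)) : ∃ P, DominatesProP p K P := by
  have := isCompact_iff_compactSpace.1 hK
  obtain ⟨P, hP⟩ := exists_minimal_primeToIndex (H := K) p hp
  refine ⟨P.map K.subtype, ?_, ?_, ?_, ?_⟩
  · rintro _ ⟨x, _, rfl⟩
    exact x.2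
  · rw [Subgroup.coe_map]
    exact hK.isClosed.isClosedEmbedding_subtypeVal.isClosedMap _ hP.prop.1
  · rintro _ ⟨x, hx, rfl⟩ U hU
    exact elemProP_of_minimal hp hP x hx (Subtype.val ⁻¹' U)
      (continuous_subtype_val.continuousAt.preimage_mem_nhds hU)
  · intro Q hQK hQ
    have hQ' : ElemProP p (Q.subgroupOf K) := by
      intro g hg U hU
      rw [nhds_induced] at hU
      obtain ⟨t, ht, hts⟩ := Filter.mem_comap.1 hU
      obtain ⟨k, hk⟩ := hQ g hg t ht
      exact ⟨k, hts hk⟩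
    obtain ⟨g, hg⟩ := exists_conj_le hp hP.prop.1 hP.prop.2 hQ'
    exact ⟨g, g.2, fun q hq => ⟨_, hg ⟨q, hQK hq⟩ hq, rfl⟩⟩

/-- S is conjugated into a dominating subgroup P, so it lies in a conjugate of P. By maximality that
conjugate is contained in S, and domination passes to S. -/
theorem dominatesProP_of_maximal {p : ℕ} (hp : p.Prime) {K S : Subgroup G}
    (hK : IsCompact (K : Set G))
    (hS : Maximal (fun P : Subgroup G => P ≤ K ∧ IsProPSubgroup p P) S) :
    DominatesProP p K S := by
  obtain ⟨P, hP⟩ := exists_dominatesProP hp hK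
  obtain ⟨hSc, hSp⟩ := (isProPSubgroup_iff hp).1 hS.prop.2
  obtain ⟨g, hg, hgS⟩ := hP.exists_conj S hS.prop.1 hSp
  have hcl := isClosed_conjBy hP.isClosed g
  have hle := conjBy_le hP.le hg
  have h := hS.le_of_ge (y := conjBy g P)
    ⟨hle, (isProPSubgroup_iff hp).2 ⟨hK.of_isClosed_subset hcl hle, hP.elemProP.conjBy g⟩⟩
    fun x hx => mem_conjBy.2 (hgS x hx)
  refine ⟨hS.prop.1, hSc.isClosed, hSp, fun Q hQK hQ => ?_⟩
  obtain ⟨k, hk, hkQ⟩ := hP.exists_conj Q hQK hQ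
  refine ⟨k * g⁻¹, K.mul_mem hk (K.inv_mem hg), fun q hq => h (mem_conjBy.2 ?_)⟩
  convert hkQ q hq using 1
  group

/-- A closed subgroup is not conjugated into a proper subgroup by an element of a compact group. -/
theorem mem_of_conj_mem {K X : Subgroup G} (hK : IsCompact (K : Set G))
    (hX : IsClosed (X : Set G)) {m : G} (hm : m ∈ K) (h : ∀ x ∈ X, m⁻¹ * x * m ∈ X) {x : G}
    (hx : m⁻¹ * x * m ∈ X) : x ∈ X := by
  by_contra hcon
  have := isCompact_iff_compactSpace.1 hK
  have hW : ∀ᶠ w in 𝓝 (1 : G), w⁻¹ * x * w ∉ X := by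
    have hc : Continuous fun w : G => w⁻¹ * x * w := by fun_prop
    refine hc.continuousAt.eventually_mem (hX.isOpen_compl.mem_nhds ?_)
    simpa using hcon
  obtain ⟨N, hN, hNo, hNW⟩ := exists_openNormal_le (H := K)
    (U := Subtype.val ⁻¹' {w : G | w⁻¹ * x * w ∉ X})
    (continuous_subtype_val.continuousAt.preimage_mem_nhds hW)
  have := N.quotient_finite_of_isOpen hNo
  -- The index of N is a positive power of m that falls into N, so close to 1 that it cannot move x
  -- into X. Iterating `h` from `hx` says that it does.
  have hpow := hNW (N.pow_index_mem (⟨m, hm⟩ : K))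
  obtain ⟨n, hn⟩ := Nat.exists_eq_succ_of_ne_zero N.index_ne_zero_of_finite
  rw [hn] at hpow
  apply hpow
  have hind : ∀ n : ℕ, (m ^ (n + 1))⁻¹ * x * m ^ (n + 1) ∈ X := by
    intro n
    induction n with
    | zero => simpa using hx
    | succ n ih =>
      convert h _ ih using 1
      rw [pow_succ m (n + 1)]
      group
  exact hind n

/-- Sylow subgroups restrict to M: a conjugate of S meets M in a pro-p group X containing P. As P
dominates M, X is conjugated into P ≤ X, and `mem_of_conj_mem` leaves no room between them. -/
theorem DominatesProP.exists_conj_inter {p : ℕ} {K S M P : Subgroup G}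
    (hS : DominatesProP p K S) (hP : DominatesProP p M P) (hMK : M ≤ K)
    (hM : IsCompact (M : Set G)) :
    ∃ k : G, ∀ x ∈ M, (k⁻¹ * x * k ∈ S ↔ x ∈ P) := by
  obtain ⟨k, -, hkP⟩ := hS.exists_conj P (hP.le.trans hMK) hP.elemProP
  refine ⟨k, fun x hxM => ⟨fun hx => ?_, hkP x⟩⟩
  let X : Subgroup G := conjBy k S ⊓ M
  have hXc : IsClosed (X : Set G) := (isClosed_conjBy hS.isClosed k).inter hM.isClosed
  have hPX : P ≤ X := fun y hy => ⟨mem_conjBy.2 (hkP y hy), hP.le hy⟩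
  obtain ⟨m, hm, hmX⟩ := hP.exists_conj X inf_le_right ((hS.elemProP.conjBy k).mono inf_le_left)
  have hxX : x ∈ X := ⟨mem_conjBy.2 hx, hxM⟩
  have hz : m * x * m⁻¹ ∈ X := by
    refine mem_of_conj_mem hM hXc hm (fun y hy => hPX (hmX y hy)) ?_
    convert hxX using 1
    group
  convert hmX _ hz using 1
  group

/-- Any two local Sylow subgroups agree near the identity, up to conjugation. -/
theorem IsLocalSylow.exists_eventually_conj {p : ℕ} (hp : p.Prime) {S S' : Subgroup G}
    (hS : IsLocalSylow p S) (hS' : IsLocalSylow p S') :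
    ∃ u : G, ∀ᶠ x in 𝓝 (1 : G), (u⁻¹ * x * u ∈ S' ↔ x ∈ S) := by
  obtain ⟨L, hLo, hLc, hSL⟩ := hS
  obtain ⟨K, hKo, hKc, hSK⟩ := hS'
  have hMc : IsCompact ((K ⊓ L : Subgroup G) : Set G) := hKc.inter hLc
  -- Suitable conjugates of S and S' both meet the open subgroup K ⊓ L in this P, so they have the
  -- same germ.
  obtain ⟨P, hP⟩ := exists_dominatesProP hp hMc
  obtain ⟨k, hk⟩ := (dominatesProP_of_maximal hp hKc hSK).exists_conj_inter hP inf_le_left hMc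
  obtain ⟨l, hl⟩ := (dominatesProP_of_maximal hp hLc hSL).exists_conj_inter hP inf_le_right hMc
  refine ⟨l⁻¹ * k, ?_⟩
  have hM : ∀ᶠ x in 𝓝 (1 : G), x ∈ K ⊓ L :=
    (hKo.inter hLo).mem_nhds (one_mem (K ⊓ L))
  filter_upwards [eventually_conj hM l⁻¹] with x hx
  have h1 := (hk _ hx).trans (hl _ hx).symm
  convert h1 using 2
  · group
  · group

theorem IsLocalSylow.isCompact {p : ℕ} (hp : p.Prime) {S : Subgroup G} (hS : IsLocalSylow p S) :
    IsCompact (S : Set G) := by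
  obtain ⟨K, -, -, hSK⟩ := hS
  exact ((isProPSubgroup_iff hp).1 hSK.prop.2).1

end LocalSylow

/-! ### Recognizing a localization -/

section Recognition

/-- The localized topology near the identity sees only the germ of S in G. -/
theorem mem_nhds_one_commLocalization {G : Type*} [Group G] [TopologicalSpace G]
    [IsTopologicalGroup G] (S : Subgroup G) (s : Set G) :
    CommLocalization.incl S ⁻¹' s ∈ 𝓝 (1 : CommLocalization S) ↔
      ∀ᶠ x in 𝓝 (1 : G), x ∈ S → x ∈ s := by
  let τ := CommLocalization.baseTopology S
  have : IsTopologicalGroup (CommLocalization.base S) :=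
    topologicalGroup_induced
      ((CommLocalization.incl S).comp (CommLocalization.base S).subtype)
  have h1 := nhds_openExtension (CommLocalization.base S) τ 1
  rw [show 𝓝 (1 : CommLocalization S) = _ from h1, Filter.mem_map, nhds_induced,
    Filter.mem_comap]
  constructor
  · rintro ⟨t, ht, hts⟩
    filter_upwards [ht] with x hx hxS
    have hxc : x ∈ Subgroup.Commensurable.commensurator S := by
      open scoped Pointwise in
      have : ConjAct.toConjAct x • S = S := Subgroup.conj_smul_eq_self_of_mem hxS
      rw [Subgroup.Commensurable.commensurator_mem_iff, this]
    have := @hts ⟨⟨x, hxc⟩, hxS⟩ hx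
    rw [Set.mem_preimage, one_mul] at this
    exact this
  · intro h
    refine ⟨_, h, fun x hx => ?_⟩
    have := hx x.2
    simpa using this

/-- The hypotheses `hcomm` and `hnhds` say that Λ is the localization at S. Since group and topology
are determined by the germ of S, a conjugation matching the germs of S' and S carries one
localization to the other. -/
theorem exists_commLocalization_equiv {A : Type*} [Group A] {Γ Λ : Subgroup A}
    [TopologicalSpace Γ] [TopologicalSpace Λ] [IsTopologicalGroup Γ] [IsTopologicalGroup Λ]
    [T2Space Γ] (hΛΓ : Λ ≤ Γ) {S S' : Subgroup Γ} (hS : IsCompact (S : Set Γ))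
    (hS' : IsCompact (S' : Set Γ)) (u : Γ)
    (hu : ∀ᶠ x in 𝓝 (1 : Γ), (u⁻¹ * x * u ∈ S' ↔ x ∈ S))
    (hcomm : ∀ γ : Γ, γ ∈ Subgroup.Commensurable.commensurator S ↔ (γ : A) ∈ Λ)
    (hnhds : ∀ s : Set A, (∀ᶠ x : Λ in 𝓝 1, (x : A) ∈ s) ↔
      ∀ᶠ x : Γ in 𝓝 1, x ∈ S → (x : A) ∈ s) :
    ∃ φ : CommLocalization S' ≃ₜ* Λ,
      ∀ x, (φ x : A) = (u * CommLocalization.incl S' x * u⁻¹ : Γ) := by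
  have := isTopologicalGroup_commLocalization S' hS'.isClosed
  have hcomm' : ∀ γ : Γ, γ ∈ Subgroup.Commensurable.commensurator S' ↔
      ((u * γ * u⁻¹ : Γ) : A) ∈ Λ := by
    intro γ
    rw [← hcomm, mem_commensurator_iff_eventually hS, mem_commensurator_iff_eventually hS']
    constructor
    · intro h
      filter_upwards [eventually_conj h u, hu, eventually_conj hu (u * γ * u⁻¹)] with x h1 h2 h3
      rw [← h3, ← h2, ← h1]
      convert Iff.rfl using 2
      group
    · intro h
      filter_upwards [eventually_conj (eventually_conj (h.and (hu.and
        (eventually_conj hu (u * γ * u⁻¹)))) 1) u⁻¹] with x hx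
      obtain ⟨h1, h2, h3⟩ := hx
      rw [← h3, ← h2] at h1
      convert h1 using 2
      · group
      · group
  let f : CommLocalization S' →* Λ :=
    { toFun := fun x => ⟨(u * CommLocalization.incl S' x * u⁻¹ : Γ), (hcomm' _).1 x.2⟩
      map_one' := Subtype.ext (by simp)
      map_mul' := fun x y => Subtype.ext (by simp [mul_assoc]) }
  have hf : ∀ x, (f x : A) = (u * CommLocalization.incl S' x * u⁻¹ : Γ) := fun _ => rfl
  have hinj : Function.Injective f := by
    intro x y hxy
    have h1 : (u * CommLocalization.incl S' x * u⁻¹ : Γ) = u * CommLocalization.incl S' y * u⁻¹ :=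
      Subtype.ext (congrArg (fun z : Λ => (z : A)) hxy)
    exact Subtype.ext (mul_left_cancel (mul_right_cancel h1))
  have hsurj : Function.Surjective f := by
    rintro ⟨y, hy⟩
    have hval : u * (u⁻¹ * (⟨y, hΛΓ hy⟩ : Γ) * u) * u⁻¹ = ⟨y, hΛΓ hy⟩ := by group
    have hmem : u⁻¹ * (⟨y, hΛΓ hy⟩ : Γ) * u ∈ Subgroup.Commensurable.commensurator S' := by
      rw [hcomm', hval]
      exact hy
    exact ⟨⟨_, hmem⟩, Subtype.ext (congrArg (fun z : Γ => (z : A)) hval)⟩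
  let e : CommLocalization S' ≃* Λ := MulEquiv.ofBijective f ⟨hinj, hsurj⟩
  -- Matching the neighbourhoods of 1 in both directions gives continuity of the isomorphism and of
  -- its inverse.
  have key : ∀ t : Set Λ, e ⁻¹' t ∈ 𝓝 (1 : CommLocalization S') ↔ t ∈ 𝓝 (1 : Λ) := by
    intro t
    have h1 : e ⁻¹' t = CommLocalization.incl S' ⁻¹'
        {x : Γ | ((u * x * u⁻¹ : Γ) : A) ∈ Subtype.val '' t} := by
      ext x
      constructor
      · exact fun hx => ⟨_, hx, rfl⟩
      · rintro ⟨y, hy, hyx⟩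
        have : y = e x := Subtype.ext hyx
        change e x ∈ t
        rwa [← this]
    have h2 : t ∈ 𝓝 (1 : Λ) ↔ ∀ᶠ x : Λ in 𝓝 1, (x : A) ∈ Subtype.val '' t := by
      rw [← Filter.eventually_mem_set]
      exact Filter.eventually_congr (Filter.Eventually.of_forall fun x => by simp)
    rw [h1, h2, hnhds, mem_nhds_one_commLocalization]
    constructor
    · intro h
      filter_upwards [eventually_conj h u, hu] with x hx hxu hxS
      convert hx (hxu.2 hxS) using 2
      group
    · intro h
      filter_upwards [eventually_conj (h.and hu) u⁻¹] with x hx hxS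
      obtain ⟨hx, hxu⟩ := hx
      have := hx (hxu.1 (by convert hxS using 1; group))
      simpa using this
  refine ⟨⟨e, ?_, ?_⟩, hf⟩
  · refine continuous_of_continuousAt_one e ?_
    intro t ht
    rw [map_one] at ht
    exact (key t).2 ht
  · refine continuous_of_continuousAt_one e.symm ?_
    intro t ht
    rw [map_one] at ht
    refine (key _).1 ?_
    convert ht using 1
    ext x
    change e.symm (e x) ∈ t ↔ _
    rw [e.symm_apply_apply]

end Recognition

/-! ### Coloured neighbours -/

namespace LegalColoring

variable {V Ω : Type*} {T : SimpleGraph V} (c : LegalColoring T Ω)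

/-- The neighbour of `v` along the edge of colour `ω`. -/
noncomputable def nb (v : V) (ω : Ω) : V := ((c.star v).symm ω).1.snd

theorem nb_color (e : T.Dart) : c.nb e.fst (c.color e) = e.snd := by
  have h : (c.star e.fst).symm (c.color e) = ⟨e, rfl⟩ := by
    rw [Equiv.symm_apply_eq]; rfl
  rw [nb, h]

theorem exists_dart (v : V) (ω : Ω) :
    ∃ e : T.Dart, e.fst = v ∧ e.snd = c.nb v ω ∧ c.color e = ω :=
  ⟨((c.star v).symm ω).1, ((c.star v).symm ω).2, rfl, (c.star v).apply_symm_apply ω⟩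

theorem adj_nb (v : V) (ω : Ω) : T.Adj v (c.nb v ω) := by
  obtain ⟨e, h1, h2, -⟩ := c.exists_dart v ω
  have h : T.Adj e.fst e.snd := e.adj
  rwa [h1, h2] at h

theorem exists_nb {v w : V} (h : T.Adj v w) : ∃ ω, c.nb v ω = w :=
  ⟨_, c.nb_color ⟨(v, w), h⟩⟩

theorem nb_nb (v : V) (ω : Ω) : c.nb (c.nb v ω) ω = v := by
  obtain ⟨e, h1, h2, h3⟩ := c.exists_dart v ω
  have := c.nb_color e.symm
  rw [c.color_symm, h3] at this
  change c.nb e.snd ω = e.fst at this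
  rwa [h2, h1] at this

theorem nb_injective (v : V) : Function.Injective (c.nb v) := by
  intro ω ω' h
  obtain ⟨e, h1, h2, h3⟩ := c.exists_dart v ω
  obtain ⟨e', h1', h2', h3'⟩ := c.exists_dart v ω'
  have : e = e' := by
    apply SimpleGraph.Dart.ext
    exact Prod.ext (h1.trans h1'.symm) (h2.trans (h.trans h2'.symm))
  rw [← h3, ← h3', this]

theorem map_nb (g : T ≃g T) (v : V) (ω : Ω) :
    g (c.nb v ω) = c.nb (g v) (c.localPerm g v ω) := by
  obtain ⟨e, rfl, h2, rfl⟩ := c.exists_dart v ω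
  rw [c.localPerm_color, ← h2]
  exact (c.nb_color (mapEdge g e)).symm

theorem localPerm_eq_of_map_nb {g : T ≃g T} {v : V} {τ : Equiv.Perm Ω}
    (h : ∀ ω, g (c.nb v ω) = c.nb (g v) (τ ω)) : c.localPerm g v = τ := by
  ext ω
  apply c.nb_injective (g v)
  rw [← h, c.map_nb]

/-- Both orientations of an edge have the same colour, so the local permutations at its ends agree
on that colour. By `exists_aut` this is the only constraint on a field of local permutations. -/
theorem localPerm_nb (g : T ≃g T) (v : V) (ω : Ω) :
    c.localPerm g (c.nb v ω) ω = c.localPerm g v ω := by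
  apply c.nb_injective (g (c.nb v ω))
  rw [← c.map_nb, c.nb_nb, c.map_nb, c.nb_nb]

/-! ### Rooted trees -/

/-- The edge of colour `ω` at `z` leads away from the root `x`. -/
def IsDown (x z : V) (ω : Ω) : Prop := T.dist x (c.nb z ω) = T.dist x z + 1

variable {c}

theorem isDown_or (hT : T.IsTree) (x z : V) (ω : Ω) :
    c.IsDown x z ω ∨ c.IsDown x (c.nb z ω) ω := by
  unfold IsDown
  rw [c.nb_nb]
  exact (hT.dist_eq_dist_add_one_of_adj x (c.adj_nb z ω)).symm

theorem exists_isDown (c : LegalColoring T Ω) (hT : T.IsTree) {x y : V} (h : y ≠ x) :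
    ∃ z ω, c.IsDown x z ω ∧ c.nb z ω = y := by
  obtain ⟨w, hw⟩ := hT.connected.exists_walk_length_eq_dist y x
  cases w with
  | nil => exact absurd rfl h
  | @cons _ z _ hadj w =>
    obtain ⟨ω, rfl⟩ := c.exists_nb hadj.symm
    refine ⟨z, ω, ?_, rfl⟩
    rcases c.isDown_or hT x z ω with h1 | h1
    · exact h1
    · unfold IsDown at h1
      rw [c.nb_nb] at h1
      have h2 := SimpleGraph.dist_le w
      rw [SimpleGraph.Walk.length_cons, SimpleGraph.dist_comm] at hw
      rw [SimpleGraph.dist_comm] at h2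
      omega

theorem root_induction (c : LegalColoring T Ω) (hT : T.IsTree) (x : V) {q : V → Prop} (h0 : q x)
    (hs : ∀ z ω, c.IsDown x z ω → q z → q (c.nb z ω)) (y : V) : q y := by
  induction h : T.dist x y generalizing y with
  | zero =>
    have : x = y := hT.connected.dist_eq_zero_iff.1 h
    rwa [← this]
  | succ n ih =>
    have hne : y ≠ x := by
      rintro rfl
      simp at h
    obtain ⟨z, ω, hz, rfl⟩ := c.exists_isDown hT hne
    exact hs z ω hz (ih z (by unfold IsDown at hz; omega))

/-- Geodesics from x extended by the two edges to y are both paths, hence equal, and so are their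
penultimate vertices. -/
theorem parent_unique (hT : T.IsTree) {x y z z' : V} (h : T.Adj z y) (h' : T.Adj z' y)
    (hd : T.dist x y = T.dist x z + 1) (hd' : T.dist x y = T.dist x z' + 1) : z = z' := by
  obtain ⟨w, hw⟩ := hT.connected.exists_walk_length_eq_dist x z
  obtain ⟨w', hw'⟩ := hT.connected.exists_walk_length_eq_dist x z'
  have h1 : (w.concat h).IsPath := SimpleGraph.Walk.isPath_of_length_eq_dist _ (by
    rw [SimpleGraph.Walk.length_concat, hw, hd])
  have h1' : (w'.concat h').IsPath := SimpleGraph.Walk.isPath_of_length_eq_dist _ (by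
    rw [SimpleGraph.Walk.length_concat, hw', hd'])
  have h2 := (hT.existsUnique_path x y).unique h1 h1'
  have h3 := congrArg SimpleGraph.Walk.penultimate h2
  simpa using h3

theorem IsDown.unique (hT : T.IsTree) {x z z' : V} {ω ω' : Ω} (h : c.IsDown x z ω)
    (h' : c.IsDown x z' ω') (heq : c.nb z ω = c.nb z' ω') : z = z' ∧ ω = ω' := by
  have hz : z = z' := by
    refine parent_unique hT (c.adj_nb z ω) (heq ▸ c.adj_nb z' ω') h ?_
    rw [heq]
    exact h'
  subst hz
  exact ⟨rfl, c.nb_injective z heq⟩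

theorem IsDown.dist_lt {x y z : V} {ω : Ω} (h : c.IsDown x z ω) (hy : c.nb z ω = y) :
    T.dist x z < T.dist x y := by
  unfold IsDown at h
  rw [hy] at h
  omega

/-- Functions on the vertices can be defined by recursion along the edges leading away from the
root. -/
theorem exists_rec (c : LegalColoring T Ω) (hT : T.IsTree) (x : V) {X : Type*} (x₀ : X)
    (step : V → Ω → X → X) :
    ∃ f : V → X, f x = x₀ ∧ ∀ z ω, c.IsDown x z ω → f (c.nb z ω) = step z ω (f z) := by
  classical
  let F : (y : V) → ((z : V) → T.dist x z < T.dist x y → X) → X := fun y rec =>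
    if h : ∃ q : V × Ω, c.IsDown x q.1 q.2 ∧ c.nb q.1 q.2 = y then
      step h.choose.1 h.choose.2 (rec h.choose.1 (h.choose_spec.1.dist_lt h.choose_spec.2))
    else x₀
  let hwf := (measure (T.dist x)).wf
  refine ⟨hwf.fix F, ?_, fun z ω hz => ?_⟩
  · rw [WellFounded.fix_eq]
    refine dif_neg ?_
    rintro ⟨⟨z, ω⟩, hz, hzx⟩
    unfold IsDown at hz
    rw [show c.nb z ω = x from hzx] at hz
    simp at hz
  · rw [WellFounded.fix_eq]
    have h : ∃ q : V × Ω, c.IsDown x q.1 q.2 ∧ c.nb q.1 q.2 = c.nb z ω := ⟨(z, ω), hz, rfl⟩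
    refine (dif_pos h).trans ?_
    obtain ⟨h1, h2⟩ := h.choose_spec.1.unique hT hz h.choose_spec.2
    change step h.choose.1 h.choose.2 (hwf.fix F h.choose.1) = _
    rw [h1, h2]

/-! ### Automorphisms with prescribed local permutations -/

/-- The map is forced outwards from the root and respects coloured neighbours up to `a`. Injectivity
of each `a z` prevents backtracking, so distances to the root are preserved; uniqueness of parents
then gives injectivity, and closure of the image under neighbours gives surjectivity. -/
theorem exists_aut (c : LegalColoring T Ω) (hT : T.IsTree) (x x' : V) (a : V → Equiv.Perm Ω)
    (ha : ∀ z ω, c.IsDown x z ω → a (c.nb z ω) ω = a z ω) :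
    ∃ g : T ≃g T, g x = x' ∧ ∀ z, c.localPerm g z = a z := by
  obtain ⟨f, hfx, hfd⟩ := c.exists_rec hT x x' (fun z ω v => c.nb v (a z ω))
  have hf : ∀ z ω, f (c.nb z ω) = c.nb (f z) (a z ω) := by
    intro z ω
    rcases c.isDown_or hT x z ω with h | h
    · exact hfd z ω h
    · have h1 := hfd _ _ h
      have h2 := ha _ _ h
      rw [c.nb_nb] at h1 h2
      rw [h1, h2, c.nb_nb]
  have hdist : ∀ n y, T.dist x y = n → T.dist x' (f y) = n := by
    intro n
    induction n using Nat.strong_induction_on with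
    | _ n ih =>
      intro y hy
      by_cases hyx : y = x
      · subst hyx
        rw [hfx, SimpleGraph.dist_self, ← hy, SimpleGraph.dist_self]
      obtain ⟨z, ω, hz, rfl⟩ := c.exists_isDown hT hyx
      have hzn : T.dist x z + 1 = n := by rw [← hy, hz]
      have hfz := ih (T.dist x z) (by omega) z rfl
      rcases c.isDown_or hT x' (f z) (a z ω) with h | h
      · rw [hf, h, hfz, hzn]
      · exfalso
        unfold IsDown at h
        rw [c.nb_nb, hfz] at h
        have hzx : z ≠ x := by
          rintro rfl
          simp at h
        obtain ⟨r, ω', hr, rfl⟩ := c.exists_isDown hT hzx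
        have hr' : T.dist x (c.nb r ω') = T.dist x r + 1 := hr
        have hfr := ih (T.dist x r) (by omega) r rfl
        have h1 : f r = c.nb (f (c.nb r ω')) (a (c.nb r ω') ω') := by rw [← hf, c.nb_nb]
        have h2 : f r = c.nb (f (c.nb r ω')) (a (c.nb r ω') ω) := by
          refine parent_unique hT (x := x') (y := f (c.nb r ω')) ?_ (c.adj_nb _ _).symm ?_ ?_
          · rw [h1]
            exact (c.adj_nb _ _).symm
          · rw [hfz, hfr, hr']
          · rw [hfz, h]
        have h3 : ω' = ω := (a (c.nb r ω')).injective (c.nb_injective _ (h1.symm.trans h2))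
        unfold IsDown at hz
        rw [h3, c.nb_nb] at hz
        rw [h3] at hr'
        omega
  have hinj : ∀ n y y', T.dist x y = n → f y = f y' → y = y' := by
    intro n
    induction n with
    | zero =>
      intro y y' hy hyy
      have h1 := hdist _ y' rfl
      rw [← hyy, hdist _ y hy] at h1
      rw [← hT.connected.dist_eq_zero_iff.1 hy, ← hT.connected.dist_eq_zero_iff.1 h1.symm]
    | succ n ih =>
      intro y y' hy hyy
      have hy' := hdist _ y' rfl
      rw [← hyy, hdist _ y hy] at hy'
      have hne : ∀ y, n + 1 = T.dist x y → y ≠ x := by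
        rintro y h rfl
        simp at h
      obtain ⟨z, ω, hz, rfl⟩ := c.exists_isDown hT (hne y hy.symm)
      obtain ⟨z', ω', hz', rfl⟩ := c.exists_isDown hT (hne y' hy')
      have hz1 : T.dist x (c.nb z ω) = T.dist x z + 1 := hz
      have hz1' : T.dist x (c.nb z' ω') = T.dist x z' + 1 := hz'
      have hd := hdist _ z rfl
      have hd' := hdist _ z' rfl
      have hzz : f z = f z' := by
        refine parent_unique hT (x := x') (y := f (c.nb z ω)) ?_ ?_ ?_ ?_
        · rw [hf]
          exact c.adj_nb _ _
        · rw [hyy, hf]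
          exact c.adj_nb _ _
        · rw [hdist _ _ rfl, hd, hz1]
        · rw [hdist _ _ rfl, hd']
          omega
      obtain rfl := ih z z' (by omega) hzz
      rw [hf, hf] at hyy
      rw [(a z).injective (c.nb_injective _ hyy)]
  have hsurj : Function.Surjective f := by
    intro w
    refine c.root_induction hT x' (q := fun w => ∃ y, f y = w) ⟨x, hfx⟩ ?_ w
    rintro _ ω - ⟨y, rfl⟩
    exact ⟨c.nb y ((a y)⁻¹ ω), by rw [hf]; simp⟩
  have hbij : Function.Bijective f := ⟨fun y y' h => hinj _ y y' rfl h, hsurj⟩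
  let g : T ≃g T :=
    { toEquiv := Equiv.ofBijective f hbij
      map_rel_iff' := by
        intro y z
        change T.Adj (f y) (f z) ↔ T.Adj y z
        constructor
        · intro h
          obtain ⟨ω, hω⟩ := c.exists_nb h
          have h1 : f z = f (c.nb y ((a y)⁻¹ ω)) := by rw [hf, ← hω]; simp
          rw [hbij.1 h1]
          exact c.adj_nb _ _
        · intro h
          obtain ⟨ω, rfl⟩ := c.exists_nb h
          rw [hf]
          exact c.adj_nb _ _ }
  exact ⟨g, hfx, fun z => c.localPerm_eq_of_map_nb (hf z)⟩

/-- Compatible local permutations on a ball extend to an automorphism that takes no further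
local permutations. -/
theorem exists_aut_extend (c : LegalColoring T Ω) (hT : T.IsTree) (x x' : V) (n : ℕ)
    (b : V → Equiv.Perm Ω)
    (hb : ∀ z ω, c.IsDown x z ω → T.dist x z < n → b (c.nb z ω) ω = b z ω) :
    ∃ g : T ≃g T, g x = x' ∧ (∀ z, T.dist x z ≤ n → c.localPerm g z = b z) ∧
      ∀ z, ∃ y, T.dist x y ≤ n ∧ c.localPerm g z = b y := by
  classical
  -- Beyond radius n each child inherits its parent's permutation, which is compatible along the
  -- edge and creates no new values.
  obtain ⟨a, hax, had⟩ := c.exists_rec hT x (b x)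
    (fun z ω τ => if T.dist x z < n then b (c.nb z ω) else τ)
  have h1 : ∀ z, (T.dist x z ≤ n → a z = b z) ∧ ∃ y, T.dist x y ≤ n ∧ a z = b y := by
    refine c.root_induction hT x ⟨fun _ => hax, x, by simp, hax⟩ ?_
    intro z ω hz ih
    have hz' : T.dist x (c.nb z ω) = T.dist x z + 1 := hz
    rw [had z ω hz]
    by_cases h : T.dist x z < n
    · rw [if_pos h]
      exact ⟨fun _ => rfl, _, by omega, rfl⟩
    · rw [if_neg h]
      exact ⟨fun _ => by omega, ih.2⟩
  obtain ⟨g, hgx, hg⟩ := c.exists_aut hT x x' a (by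
    intro z ω hz
    have hz' : T.dist x (c.nb z ω) = T.dist x z + 1 := hz
    rw [had z ω hz]
    by_cases h : T.dist x z < n
    · rw [if_pos h, (h1 z).1 h.le, hb z ω hz h]
    · rw [if_neg h])
  refine ⟨g, hgx, fun z hz => (hg z).trans ((h1 z).1 hz), fun z => ?_⟩
  obtain ⟨y, hy, hzy⟩ := (h1 z).2
  exact ⟨y, hy, (hg z).trans hzy⟩

theorem eq_on_ball (c : LegalColoring T Ω) (hT : T.IsTree) {x : V} {g h : T ≃g T} {n : ℕ}
    (hx : g x = h x) (hgh : ∀ z, T.dist x z < n → c.localPerm g z = c.localPerm h z) (z : V)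
    (hz : T.dist x z ≤ n) : g z = h z := by
  refine c.root_induction hT x (q := fun z => T.dist x z ≤ n → g z = h z) (fun _ => hx) ?_ z hz
  intro z ω hd ih hn
  have hd' : T.dist x (c.nb z ω) = T.dist x z + 1 := hd
  rw [c.map_nb, c.map_nb, ih (by omega), hgh z (by omega)]

/-- An automorphism that fixes the ball around `x` up to `y`, with prescribed local permutation at
`y`. -/
theorem exists_aut_localPerm_eq (c : LegalColoring T Ω) (hT : T.IsTree) (x y : V)
    (H : Subgroup (Equiv.Perm Ω)) {τ : Equiv.Perm Ω} (hτ : τ ∈ H)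
    (hfix : ∀ ω, c.IsDown x (c.nb y ω) ω → τ ω = ω) :
    ∃ g ∈ burgerMozes c H, (∀ z, T.dist x z ≤ T.dist x y → g z = z) ∧ c.localPerm g y = τ := by
  classical
  -- Within the ball up to y the field is trivial except at y, so the only condition is that τ fix
  -- the colour of the edge from y to its parent.
  obtain ⟨g, hgx, hg, hgb⟩ := c.exists_aut_extend hT x x (T.dist x y)
    (fun z => if z = y then τ else 1) (by
      intro z ω hz hlt
      have h1 : z ≠ y := by
        rintro rfl
        exact lt_irrefl _ hlt
      rw [if_neg h1]
      split_ifs with h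
      · refine hfix ω ?_
        rw [← h, c.nb_nb]
        exact hz
      · rfl)
  refine ⟨g, fun z => ?_, fun z hz => ?_, ?_⟩
  · obtain ⟨w, -, hw⟩ := hgb z
    rw [hw]
    split_ifs
    · exact hτ
    · exact H.one_mem
  · refine c.eq_on_ball hT (h := 1) hgx (fun w hw => ?_) z hz
    have h1 : w ≠ y := by
      rintro rfl
      exact lt_irrefl _ hw
    rw [hg w hw.le, if_neg h1, c.localPerm_one]
  · rw [hg y le_rfl, if_pos rfl]

theorem finite_ball [Finite Ω] (c : LegalColoring T Ω) (hT : T.IsTree) (x : V) (n : ℕ) :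
    {z | T.dist x z ≤ n}.Finite := by
  induction n with
  | zero =>
    refine (Set.finite_singleton x).subset fun z hz => ?_
    exact (hT.connected.dist_eq_zero_iff.1 (Nat.le_zero.1 hz)).symm
  | succ n ih =>
    refine (ih.union ((ih.prod (Set.finite_univ (α := Ω))).image
      fun q => c.nb q.1 q.2)).subset fun z hz => ?_
    by_cases hzx : z = x
    · left
      simp [hzx]
    · obtain ⟨w, ω, hw, rfl⟩ := c.exists_isDown hT hzx
      refine Or.inr ⟨(w, ω), ⟨?_, trivial⟩, rfl⟩
      have h1 : T.dist x (c.nb w ω) = T.dist x w + 1 := hw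
      have h2 : T.dist x (c.nb w ω) ≤ n + 1 := hz
      change T.dist x w ≤ n
      omega

end LegalColoring

theorem exists_dist_bound {V : Type*} (T : SimpleGraph V) (x : V) {A : Set V} (hA : A.Finite) :
    ∃ n, ∀ z ∈ A, T.dist x z ≤ n := by
  obtain ⟨n, hn⟩ := (hA.image (T.dist x)).bddAbove
  exact ⟨n, fun z hz => hn ⟨z, hz, rfl⟩⟩

/-! ### Self-normalizing point stabilizers -/

section PermGroupLemmas

/-- A subgroup of a finite `p`-group that is its own normalizer there is the whole group. -/
theorem le_of_normalizer_inf_le {G : Type*} [Group G] [Finite G] {p : ℕ} (hp : p.Prime)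
    {D R : Subgroup G} (hR : IsPGroup p R) (hDR : D ≤ R)
    (h : ∀ r ∈ R, (∀ d ∈ D, r * d * r⁻¹ ∈ D) → r ∈ D) : R ≤ D := by
  have := Fact.mk hp
  have hnil := hR.isNilpotent
  by_contra hcon
  have hlt : D.subgroupOf R < ⊤ := by
    rw [lt_top_iff_ne_top]
    exact fun h => hcon (Subgroup.subgroupOf_eq_top.1 h)
  obtain ⟨r, hr, hrD⟩ := SetLike.exists_of_lt
    (Group.normalizerCondition_of_isNilpotent (G := R) _ hlt)
  refine hrD (h r r.2 fun d hd => ?_)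
  exact (Subgroup.mem_normalizer_iff.1 hr ⟨d, hDR hd⟩).1 hd

variable {Ω : Type*}

theorem mem_pointStab {F : Subgroup (Equiv.Perm Ω)} {ω : Ω} {τ : Equiv.Perm Ω} :
    τ ∈ pointStab F ω ↔ τ ∈ F ∧ τ ω = ω := Iff.rfl

/-- Finiteness turns the one-sided containment of the conjugate into normalization. -/
theorem mem_pointStab_of_conj [Finite Ω] {F' D : Subgroup (Equiv.Perm Ω)} {ω : Ω}
    (hnorm : Subgroup.normalizer (pointStab D ω : Set (Equiv.Perm Ω)) ⊓ pointStab F' ω =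
      pointStab D ω) {a : Equiv.Perm Ω} (ha : a ∈ pointStab F' ω)
    (h : ∀ τ ∈ pointStab D ω, a * τ * a⁻¹ ∈ pointStab D ω) : a ∈ pointStab D ω := by
  rw [← hnorm]
  exact ⟨Subgroup.mem_normalizer_fintype h, ha⟩

theorem mem_of_conj_pointStab_le [Finite Ω] {F' D : Subgroup (Equiv.Perm Ω)} {ω : Ω}
    (hDF' : D ≤ F') (horb : ∀ a ∈ F', a ω ∈ MulAction.orbit D ω)
    (hnorm : Subgroup.normalizer (pointStab D ω : Set (Equiv.Perm Ω)) ⊓ pointStab F' ω =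
      pointStab D ω) {a : Equiv.Perm Ω} (ha : a ∈ F')
    (h : ∀ τ ∈ pointStab D ω, a * τ * a⁻¹ ∈ D) : a ∈ D := by
  -- Since f ∈ D agrees with a at ω, f⁻¹a fixes ω and still conjugates D_ω into D, hence into D_ω.
  obtain ⟨⟨f, hf⟩, hfa⟩ := horb a ha
  change f ω = a ω at hfa
  have hfix : (f⁻¹ * a) ω = ω := by
    rw [Equiv.Perm.mul_apply, ← hfa]
    exact f.symm_apply_apply ω
  have hinv : (f⁻¹ * a)⁻¹ ω = ω := by
    rw [Equiv.Perm.inv_eq_iff_eq, hfix]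
  have h1 : f⁻¹ * a ∈ pointStab D ω := by
    refine mem_pointStab_of_conj hnorm ⟨F'.mul_mem (F'.inv_mem (hDF' hf)) ha, hfix⟩
      fun τ hτ => ⟨?_, ?_⟩
    · have := D.mul_mem (D.mul_mem (D.inv_mem hf) (h τ hτ)) hf
      have h2 : f⁻¹ * a * τ * (f⁻¹ * a)⁻¹ = f⁻¹ * (a * τ * a⁻¹) * f := by group
      change f⁻¹ * a * τ * (f⁻¹ * a)⁻¹ ∈ D
      rwa [h2]
    · change (f⁻¹ * a * τ * (f⁻¹ * a)⁻¹) ω = ω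
      rw [Equiv.Perm.mul_apply, hinv, Equiv.Perm.mul_apply, (mem_pointStab.1 hτ).2, hfix]
  have := D.mul_mem hf h1.1
  rwa [mul_inv_cancel_left] at this

end PermGroupLemmas

/-! ### Vertex stabilizers in universal groups -/

section VertexStabilizers

variable {V Ω : Type*} {T : SimpleGraph V}

theorem burgerMozes_mono (c : LegalColoring T Ω) {H F : Subgroup (Equiv.Perm Ω)} (h : H ≤ F) :
    burgerMozes c H ≤ burgerMozes c F :=
  fun _ hg x => h (hg x)

theorem burgerMozes_le_leBoudec (c : LegalColoring T Ω) {F F' : Subgroup (Equiv.Perm Ω)}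
    (h : F ≤ F') : burgerMozes c F ≤ leBoudec c F F' := by
  intro g hg
  refine ⟨?_, burgerMozes_mono c h hg⟩
  have : {x : V | c.localPerm g x ∉ F} = ∅ := by
    ext x
    simp [hg x]
  change {x : V | c.localPerm g x ∉ F}.Finite
  rw [this]
  exact Set.finite_empty

theorem leBoudec_mono (c : LegalColoring T Ω) {H F F' : Subgroup (Equiv.Perm Ω)} (h : H ≤ F) :
    leBoudec c H F' ≤ leBoudec c F F' :=
  fun _ hg => ⟨Set.Finite.subset hg.1 fun _ hx hH => hx (h hH), hg.2⟩

/-- The pointwise stabilizer of a set of vertices in `U(H)`, as a subgroup of `Γ`. -/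
def fixIn (c : LegalColoring T Ω) (H : Subgroup (Equiv.Perm Ω)) (Γ : Subgroup (T ≃g T))
    (A : Set V) : Subgroup Γ where
  carrier := {g | (g : T ≃g T) ∈ burgerMozes c H ∧ ∀ x ∈ A, (g : T ≃g T) x = x}
  one_mem' := ⟨one_mem _, fun _ _ => rfl⟩
  mul_mem' {g h} hg hh := ⟨mul_mem hg.1 hh.1, fun x hx => by
    change (g : T ≃g T) ((h : T ≃g T) x) = x
    rw [hh.2 x hx, hg.2 x hx]⟩
  inv_mem' {g} hg := ⟨inv_mem hg.1, fun x hx => by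
    change (g : T ≃g T).symm x = x
    rw [RelIso.symm_apply_eq, hg.2 x hx]⟩

/-- The pointwise stabilizers in `U(F)` of finite sets of vertices form a basis of neighbourhoods
of the identity of `Γ`. -/
def HasFixBasis (c : LegalColoring T Ω) (F : Subgroup (Equiv.Perm Ω)) (Γ : Subgroup (T ≃g T))
    [TopologicalSpace Γ] : Prop :=
  ∀ s : Set Γ, s ∈ 𝓝 (1 : Γ) ↔ ∃ A : Set V, A.Finite ∧ (fixIn c F Γ A : Set Γ) ⊆ s

theorem mem_nhds_induced_autTopology {G : Type*} [Group G] (f : G →* (T ≃g T)) (s : Set G) :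
    s ∈ @nhds G (TopologicalSpace.induced f (autTopology T)) 1 ↔
      ∃ A : Set V, A.Finite ∧ ∀ g, (∀ x ∈ A, f g x = x) → g ∈ s := by
  let := autTopology T
  rw [nhds_induced, Filter.mem_comap, map_one]
  constructor
  · rintro ⟨t, ht, hts⟩
    obtain ⟨A, hA, hAt⟩ := exists_finite_fixator ht
    exact ⟨A, hA, fun g hg => hts (hAt _ hg)⟩
  · rintro ⟨A, hA, h⟩
    exact ⟨_, fixator_mem_nhds hA, fun g hg => h g hg⟩

theorem hasFixBasis_burgerMozes (c : LegalColoring T Ω) (F : Subgroup (Equiv.Perm Ω)) :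
    HasFixBasis c F (burgerMozes c F) := by
  intro s
  refine (mem_nhds_induced_autTopology (burgerMozes c F).subtype s).trans ?_
  refine exists_congr fun A => and_congr_right fun _ => ?_
  exact ⟨fun h g hg => h g hg.2, fun h g hg => h ⟨g.2, hg⟩⟩

theorem hasFixBasis_leBoudec (c : LegalColoring T Ω) (F F' : Subgroup (Equiv.Perm Ω)) :
    HasFixBasis c F (leBoudec c F F') := by
  intro s
  let τA := autTopology T
  have := isTopologicalGroup_aut T
  let τ := burgerMozesInTopology c F F'
  let j : burgerMozesIn c F F' →* (T ≃g T) :=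
    (leBoudec c F F').subtype.comp (burgerMozesIn c F F').subtype
  have : IsTopologicalGroup (burgerMozesIn c F F') := topologicalGroup_induced j
  have h1 := nhds_openExtension (burgerMozesIn c F F') τ 1
  rw [show 𝓝 (1 : leBoudec c F F') = _ from h1, Filter.mem_map]
  refine (mem_nhds_induced_autTopology j _).trans ?_
  refine exists_congr fun A => and_congr_right fun _ => ⟨fun h g hg => ?_, fun h g hg => ?_⟩
  · have := h ⟨g, hg.1⟩ hg.2
    rwa [Set.mem_preimage, one_mul] at this
  · rw [Set.mem_preimage, one_mul]
    exact h ⟨g.2, hg⟩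

/-! ### Compactness and the pro-p property of vertex stabilizers -/

variable {c : LegalColoring T Ω} {F : Subgroup (Equiv.Perm Ω)} {Γ : Subgroup (T ≃g T)}
  [TopologicalSpace Γ]

theorem HasFixBasis.fixIn_mem_nhds (hΓ : HasFixBasis c F Γ) {A : Set V} (hA : A.Finite) :
    (fixIn c F Γ A : Set Γ) ∈ 𝓝 (1 : Γ) :=
  (hΓ _).2 ⟨A, hA, le_rfl⟩

theorem HasFixBasis.t2Space [IsTopologicalGroup Γ] (hΓ : HasFixBasis c F Γ) : T2Space Γ := by
  refine IsTopologicalGroup.t2Space_of_one_sep fun g hg => ?_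
  obtain ⟨v, hv⟩ : ∃ v, (g : T ≃g T) v ≠ v := by
    by_contra! h
    exact hg (Subtype.ext (RelIso.ext h))
  exact ⟨_, hΓ.fixIn_mem_nhds (Set.finite_singleton v), fun h => hv (h.2 v rfl)⟩

theorem HasFixBasis.isOpen_fixIn [IsTopologicalGroup Γ] (hΓ : HasFixBasis c F Γ) {A : Set V}
    (hA : A.Finite) : IsOpen (fixIn c F Γ A : Set Γ) :=
  Subgroup.isOpen_of_mem_nhds _ (hΓ.fixIn_mem_nhds hA)

theorem HasFixBasis.nonarchimedeanGroup [IsTopologicalGroup Γ] (hΓ : HasFixBasis c F Γ) :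
    NonarchimedeanGroup Γ where
  is_nonarchimedean U hU := by
    obtain ⟨A, hA, hAU⟩ := (hΓ U).1 hU
    exact ⟨⟨fixIn c F Γ A, hΓ.isOpen_fixIn hA⟩, hAU⟩

theorem HasFixBasis.isCompact_fixIn [Finite Ω] [IsTopologicalGroup Γ] (hΓ : HasFixBasis c F Γ)
    (hT : T.IsTree) (hFΓ : burgerMozes c F ≤ Γ) {H : Subgroup (Equiv.Perm Ω)} (hH : H ≤ F)
    (x : V) : IsCompact (fixIn c H Γ {x} : Set Γ) := by
  let : TopologicalSpace (Equiv.Perm Ω) := ⊥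
  have : DiscreteTopology (Equiv.Perm Ω) := ⟨rfl⟩
  -- Compatible fields with values in H form a closed subset of a product of finite discrete spaces.
  -- The stabilizer of x in U(H) is its image under the map sending a field to the automorphism
  -- fixing x with that field.
  let C : Set (V → Equiv.Perm Ω) := {a | (∀ z, a z ∈ H) ∧ ∀ z ω, a (c.nb z ω) ω = a z ω}
  have hC : IsClosed C := by
    have : C = (⋂ z, (fun a => a z) ⁻¹' (H : Set (Equiv.Perm Ω))) ∩
        ⋂ z, ⋂ ω, (fun a : V → Equiv.Perm Ω => (a (c.nb z ω), a z)) ⁻¹'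
          {q | q.1 ω = q.2 ω} := by
      ext a
      simp [C]
    rw [this]
    refine (isClosed_iInter fun z => (isClosed_discrete _).preimage (continuous_apply z)).inter
      (isClosed_iInter fun z => isClosed_iInter fun ω => (isClosed_discrete _).preimage ?_)
    fun_prop
  have : CompactSpace C := isCompact_iff_compactSpace.1 hC.isCompact
  have hex : ∀ a : C, ∃ g : T ≃g T, g x = x ∧ ∀ z, c.localPerm g z = a.1 z :=
    fun a => c.exists_aut hT x x a.1 fun z ω _ => a.2.2 z ω
  choose f hfx hf using hex
  have hfH : ∀ a, f a ∈ burgerMozes c H := fun a z => by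
    rw [hf]
    exact a.2.1 z
  let Φ : C → Γ := fun a => ⟨f a, hFΓ (burgerMozes_mono c hH (hfH a))⟩
  have hΦ : Continuous Φ := by
    rw [continuous_iff_continuousAt]
    intro a s hs
    have h1 : (fun h => Φ a * h) ⁻¹' s ∈ 𝓝 (1 : Γ) := by
      apply (continuous_const_mul (Φ a)).continuousAt
      change s ∈ 𝓝 (Φ a * 1)
      rwa [mul_one]
    obtain ⟨A, hA, hAs⟩ := (hΓ _).1 h1
    obtain ⟨n, hn⟩ := exists_dist_bound T x hA
    have h2 : ∀ᶠ a' : C in 𝓝 a, ∀ z ∈ {z | T.dist x z ≤ n}, a'.1 z = a.1 z := by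
      refine (Filter.eventually_all_finite (c.finite_ball hT x n)).2 fun z _ => ?_
      have h3 : Continuous fun a' : C => a'.1 z := (continuous_apply z).comp continuous_subtype_val
      exact h3.continuousAt.eventually_mem ((isOpen_discrete {a.1 z}).mem_nhds rfl)
    refine Filter.mem_map.2 (Filter.mem_of_superset h2 fun a' ha' => ?_)
    have h4 : (Φ a)⁻¹ * Φ a' ∈ fixIn c F Γ A := by
      refine ⟨?_, fun z hz => ?_⟩
      · exact mul_mem (inv_mem (burgerMozes_mono c hH (hfH a))) (burgerMozes_mono c hH (hfH a'))
      · change (f a).symm (f a' z) = z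
        rw [RelIso.symm_apply_eq]
        refine c.eq_on_ball hT ((hfx a').trans (hfx a).symm) (fun w hw => ?_) z (hn z hz)
        rw [hf, hf]
        exact ha' w hw.le
    have := hAs h4
    rwa [Set.mem_preimage, mul_inv_cancel_left] at this
  convert isCompact_range hΦ using 1
  ext g
  constructor
  · intro hg
    let a : C := ⟨fun z => c.localPerm g z, hg.1, fun z ω => c.localPerm_nb _ z ω⟩
    refine ⟨a, Subtype.ext (RelIso.ext fun z => ?_)⟩
    exact c.eq_on_ball hT ((hfx a).trans (hg.2 x rfl).symm) (fun w _ => hf a w) z le_rfl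
  · rintro ⟨a, rfl⟩
    exact ⟨hfH a, fun _ hz => hz ▸ hfx a⟩

theorem localPerm_pow_of_fixes (c : LegalColoring T Ω) {g : T ≃g T} {y : V} (h : g y = y) (n : ℕ) :
    (g ^ n) y = y ∧ c.localPerm (g ^ n) y = c.localPerm g y ^ n := by
  induction n with
  | zero => exact ⟨rfl, c.localPerm_one y⟩
  | succ n ih =>
    rw [pow_succ, pow_succ, c.localPerm_mul, h, ih.2]
    exact ⟨by rw [RelIso.mul_apply, h, ih.1], rfl⟩

theorem HasFixBasis.elemProP_fixIn [Finite Ω] (hΓ : HasFixBasis c F Γ) (hT : T.IsTree) {p : ℕ}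
    (hp : p.Prime) {H : Subgroup (Equiv.Perm Ω)} (hH : H ≤ F) (hpH : IsPGroup p H) (x : V) :
    ElemProP p (fixIn c H Γ {x}) := by
  have := Fact.mk hp
  intro g hg U hU
  obtain ⟨A, hA, hAU⟩ := (hΓ U).1 hU
  obtain ⟨n, hn⟩ := exists_dist_bound T x hA
  obtain ⟨m, hm⟩ := IsPGroup.iff_card.1 hpH
  have key : ∀ n, ∃ k : ℕ, ∀ z, T.dist x z ≤ n → ((g : T ≃g T) ^ p ^ k) z = z := by
    intro n
    induction n with
    | zero =>
      refine ⟨0, fun z hz => ?_⟩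
      rw [← hT.connected.dist_eq_zero_iff.1 (Nat.le_zero.1 hz), pow_zero, pow_one]
      exact hg.2 x rfl
    | succ n ih =>
      obtain ⟨k, hk⟩ := ih
      -- With |H| = p^m, once a power fixes the ball of radius n, its p^m-th power has trivial local
      -- permutations there and so fixes the next sphere.
      refine ⟨k + m, fun z hz => ?_⟩
      rw [pow_add, pow_mul]
      set h := (g : T ≃g T) ^ p ^ k with hdef
      have hmem : h ∈ burgerMozes c H := pow_mem hg.1 _
      by_cases hzx : z = x
      · exact (localPerm_pow_of_fixes c (hk z (by rw [hzx]; simp)) _).1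
      · obtain ⟨w, ω, hw, rfl⟩ := c.exists_isDown hT hzx
        have hw' : T.dist x (c.nb w ω) = T.dist x w + 1 := hw
        obtain ⟨h1, h2⟩ := localPerm_pow_of_fixes c (hk w (by omega)) (p ^ m)
        have h3 : c.localPerm h w ^ p ^ m = 1 := by
          have := pow_card_eq_one' (x := (⟨_, hmem w⟩ : H))
          rw [hm] at this
          exact congrArg Subtype.val this
        rw [c.map_nb, h1, h2, h3, Equiv.Perm.one_apply]
  obtain ⟨k, hk⟩ := key n
  exact ⟨k, hAU ⟨burgerMozes_mono c hH (pow_mem hg.1 _), fun z hz => hk z (hn z hz)⟩⟩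

/-! ### Maximality of U(D)_x and almost locally D-like automorphisms -/

/-- The local permutations at `y` of the elements of `Q` that fix `y` and `r`. -/
def localGroup (c : LegalColoring T Ω) (Q : Subgroup Γ) (y r : V) : Subgroup (Equiv.Perm Ω) where
  carrier := {τ | ∃ k ∈ Q, (k : T ≃g T) y = y ∧ (k : T ≃g T) r = r ∧ c.localPerm k y = τ}
  one_mem' := ⟨1, one_mem _, rfl, rfl, c.localPerm_one y⟩
  mul_mem' := by
    rintro _ _ ⟨g, hg, hgy, hgr, rfl⟩ ⟨h, hh, hhy, hhr, rfl⟩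
    refine ⟨g * h, mul_mem hg hh, ?_, ?_, ?_⟩
    · change (g : T ≃g T) ((h : T ≃g T) y) = y
      rw [hhy, hgy]
    · change (g : T ≃g T) ((h : T ≃g T) r) = r
      rw [hhr, hgr]
    · rw [Subgroup.coe_mul, c.localPerm_mul, hhy]
  inv_mem' := by
    rintro _ ⟨g, hg, hgy, hgr, rfl⟩
    have h1 : (g : T ≃g T)⁻¹ y = y := (RelIso.symm_apply_eq _).2 hgy.symm
    have h2 : (g : T ≃g T)⁻¹ r = r := (RelIso.symm_apply_eq _).2 hgr.symm
    exact ⟨g⁻¹, inv_mem hg, h1, h2, by rw [Subgroup.coe_inv, c.localPerm_inv, h1]⟩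

/-- Some p-power of an element of Q is close enough to 1 to fix y and its neighbours, so the local
permutation has p-power order. -/
theorem HasFixBasis.isPGroup_localGroup [Finite Ω] (hΓ : HasFixBasis c F Γ) {p : ℕ}
    {Q : Subgroup Γ} (hQ : ElemProP p Q) (y r : V) : IsPGroup p (localGroup c Q y r) := by
  rintro ⟨_, k, hk, hky, hkr, rfl⟩
  have hA : ({y} ∪ {z | T.Adj y z}).Finite := (Set.finite_singleton y).union (finite_neighbors c y)
  obtain ⟨j, hj⟩ := hQ k hk _ (hΓ.fixIn_mem_nhds hA)
  refine ⟨j, Subtype.ext ?_⟩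
  change c.localPerm k y ^ p ^ j = 1
  rw [← (localPerm_pow_of_fixes c hky _).2]
  exact localPerm_eq_one_of_fixes c _ y (hj.2 y (Or.inl rfl)) fun z hz => hj.2 z (Or.inr hz)

theorem HasFixBasis.le_fixIn_of_elemProP [Finite Ω] (hΓ : HasFixBasis c F Γ)
    (hT : T.IsTree) {p : ℕ} (hFΓ : burgerMozes c F ≤ Γ)
    {D : Subgroup (Equiv.Perm Ω)} (hDF : D ≤ F)
    (hroot : ∀ R : Subgroup (Equiv.Perm Ω), IsPGroup p R → D ≤ R → R ≤ F → R ≤ D)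
    (hstab : ∀ (ω : Ω) (R : Subgroup (Equiv.Perm Ω)), IsPGroup p R → pointStab D ω ≤ R →
      R ≤ pointStab F ω → R ≤ pointStab D ω) {x : V} {Q : Subgroup Γ} (hQ : ElemProP p Q)
    (hDQ : fixIn c D Γ {x} ≤ Q) (hQF : Q ≤ fixIn c F Γ {x}) : Q ≤ fixIn c D Γ {x} := by
  have hΓD : ∀ g ∈ burgerMozes c D, g ∈ Γ := fun g hg => hFΓ (burgerMozes_mono c hDF hg)
  have key : ∀ n y, T.dist x y = n → ∀ q ∈ Q, c.localPerm q y ∈ D := by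
    intro n
    induction n using Nat.strong_induction_on with
    | _ n ih =>
      intro y hy q hq
      by_cases hyx : y = x
      · subst hyx
        have hqy := (hQF hq).2 y rfl
        -- At the root no edge colour need be fixed, so the full local group is compared with D.
        refine hroot (localGroup c Q y y) (hΓ.isPGroup_localGroup hQ y y) (fun τ hτ => ?_) ?_
          ⟨q, hq, hqy, hqy, rfl⟩
        · obtain ⟨k, hk, hkfix, hkτ⟩ := c.exists_aut_localPerm_eq hT y y D hτ (by
            intro ω hω
            have h1 : T.dist y (c.nb (c.nb y ω) ω) = T.dist y (c.nb y ω) + 1 := hω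
            rw [c.nb_nb] at h1
            simp at h1)
          have hky := hkfix y le_rfl
          refine ⟨⟨k, hΓD k hk⟩, hDQ ⟨hk, ?_⟩, hky, hky, hkτ⟩
          rintro z rfl
          exact hky
        · rintro _ ⟨k, hk, -, -, rfl⟩
          exact (hQF hk).1 y
      · obtain ⟨r, ω, hr, rfl⟩ := c.exists_isDown hT hyx
        have hr' : T.dist x (c.nb r ω) = T.dist x r + 1 := hr
        -- s copies q up to the parent r and takes no new local permutations, so by induction it
        -- lies in U(D)_x ≤ Q. Then s⁻¹q fixes both r and its child, and only its local permutation
        -- at the child matters.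
        obtain ⟨s, hsx, hsq, hsr⟩ := c.exists_aut_extend hT x x (T.dist x r) (c.localPerm q)
          (fun z ω _ _ => c.localPerm_nb _ z ω)
        have hsD : s ∈ burgerMozes c D := by
          intro z
          obtain ⟨w, hw, hzw⟩ := hsr z
          rw [hzw]
          exact ih _ (by omega) w rfl q hq
        have hsQ : (⟨s, hΓD s hsD⟩ : Γ) ∈ Q := hDQ ⟨hsD, by rintro z rfl; exact hsx⟩
        have hfix : ∀ z, T.dist x z ≤ T.dist x r + 1 → s⁻¹ ((q : T ≃g T) z) = z := by
          intro z hz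
          refine (RelIso.symm_apply_eq _).2 ?_
          refine (c.eq_on_ball hT (hsx.trans ((hQF hq).2 x rfl).symm) (fun w hw => ?_) z hz).symm
          exact hsq w (by omega)
        let sΓ : Γ := ⟨s, hΓD s hsD⟩
        have hk0 : sΓ⁻¹ * q ∈ Q := mul_mem (inv_mem hsQ) hq
        have hk1 : ((sΓ⁻¹ * q : Γ) : T ≃g T) (c.nb r ω) = c.nb r ω := hfix _ hr'.le
        have hk2 : ((sΓ⁻¹ * q : Γ) : T ≃g T) r = r := hfix _ (by omega)
        have hmem : c.localPerm ((sΓ⁻¹ * q : Γ) : T ≃g T) (c.nb r ω) ∈ pointStab D ω := by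
          refine hstab ω (localGroup c Q (c.nb r ω) r) (hΓ.isPGroup_localGroup hQ _ _) ?_ ?_
            ⟨sΓ⁻¹ * q, hk0, hk1, hk2, rfl⟩
          · rintro τ ⟨hτ, hτω⟩
            obtain ⟨k, hk, hkfix, hkτ⟩ := c.exists_aut_localPerm_eq hT x (c.nb r ω) D hτ (by
              intro ω' hω'
              rw [← (hr.unique hT hω' (by rw [c.nb_nb])).2]
              exact hτω)
            refine ⟨⟨k, hΓD k hk⟩, hDQ ⟨hk, ?_⟩, hkfix _ le_rfl, hkfix _ (by omega), hkτ⟩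
            rintro z rfl
            exact hkfix z (by simp)
          · rintro _ ⟨k, hk, hky, hkr, rfl⟩
            -- An element fixing the child and its parent r fixes the colour ω of the edge between
            -- them.
            refine ⟨(hQF hk).1 _, ?_⟩
            change c.localPerm k (c.nb r ω) ω = ω
            apply c.nb_injective (c.nb r ω)
            have h1 := c.map_nb (k : T ≃g T) (c.nb r ω) ω
            rw [c.nb_nb, hkr, hky] at h1
            rw [← h1, c.nb_nb]
        have h1 : c.localPerm q (c.nb r ω) =
            c.localPerm s (c.nb r ω) * c.localPerm ((sΓ⁻¹ * q : Γ) : T ≃g T) (c.nb r ω) := by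
          have h2 := c.localPerm_mul s ((sΓ⁻¹ * q : Γ) : T ≃g T) (c.nb r ω)
          have h3 : s * ((sΓ⁻¹ * q : Γ) : T ≃g T) = q := mul_inv_cancel_left s (q : T ≃g T)
          rwa [h3, hk1] at h2
        rw [h1]
        exact D.mul_mem (hsD _) hmem.1
  exact fun q hq => ⟨fun y => key _ y rfl q hq, (hQF hq).2⟩

theorem HasFixBasis.isLocalSylow_fixIn [Finite Ω] [IsTopologicalGroup Γ]
    (hΓ : HasFixBasis c F Γ) (hT : T.IsTree) {p : ℕ} (hp : p.Prime) (hFΓ : burgerMozes c F ≤ Γ)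
    {D : Subgroup (Equiv.Perm Ω)} (hDF : D ≤ F) (hpD : IsPGroup p D)
    (hroot : ∀ R : Subgroup (Equiv.Perm Ω), IsPGroup p R → D ≤ R → R ≤ F → R ≤ D)
    (hstab : ∀ (ω : Ω) (R : Subgroup (Equiv.Perm Ω)), IsPGroup p R → pointStab D ω ≤ R →
      R ≤ pointStab F ω → R ≤ pointStab D ω) (x : V) :
    IsLocalSylow p (fixIn c D Γ {x}) := by
  have := hΓ.t2Space
  have := hΓ.nonarchimedeanGroup
  refine ⟨fixIn c F Γ {x}, hΓ.isOpen_fixIn (Set.finite_singleton x),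
    hΓ.isCompact_fixIn hT hFΓ le_rfl x, ⟨?_, ?_⟩, fun Q hQ hle => ?_⟩
  · exact fun g hg => ⟨burgerMozes_mono c hDF hg.1, hg.2⟩
  · exact (isProPSubgroup_iff hp).2
      ⟨hΓ.isCompact_fixIn hT hFΓ hDF x, hΓ.elemProP_fixIn hT hp hDF hpD x⟩
  · exact hΓ.le_fixIn_of_elemProP hT hFΓ hDF hroot hstab
      ((isProPSubgroup_iff hp).1 hQ.2).2 hle hQ.1

theorem HasFixBasis.mem_almostBurgerMozes [Finite Ω] (hΓ : HasFixBasis c F Γ) (hT : T.IsTree)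
    (hFΓ : burgerMozes c F ≤ Γ) {D F' : Subgroup (Equiv.Perm Ω)} (hDF : D ≤ F)
    (hself : ∀ ω, ∀ a ∈ F', (∀ τ ∈ pointStab D ω, a * τ * a⁻¹ ∈ D) → a ∈ D) {x : V} {γ : Γ}
    (hγ : (γ : T ≃g T) ∈ burgerMozes c F')
    (h : ∀ᶠ k in 𝓝 (1 : Γ), k ∈ fixIn c D Γ {x} → γ * k * γ⁻¹ ∈ fixIn c D Γ {x}) :
    (γ : T ≃g T) ∈ almostBurgerMozes c D := by
  obtain ⟨A, hA, hAh⟩ := (hΓ _).1 h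
  obtain ⟨n, hn⟩ := exists_dist_bound T x hA
  refine (c.finite_ball hT x n).subset fun y hy => ?_
  by_contra hcon
  change ¬ T.dist x y ≤ n at hcon
  have hyx : y ≠ x := by
    rintro rfl
    simp at hcon
  obtain ⟨r, ω, hr, rfl⟩ := c.exists_isDown hT hyx
  -- For y outside the ball, an element of U(D) fixing everything up to y can have any τ ∈ D_ω at y.
  -- Its conjugate by γ lies in S, and has local permutation σ(γ,y) τ σ(γ,y)⁻¹ at γy.
  refine hy (hself ω _ (hγ _) fun τ hτ => ?_)
  obtain ⟨k, hk, hkfix, hkτ⟩ := c.exists_aut_localPerm_eq hT x (c.nb r ω) D hτ.1 (by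
    intro ω' hω'
    rw [← (hr.unique hT hω' (by rw [c.nb_nb])).2]
    exact hτ.2)
  have hkF := burgerMozes_mono c hDF hk
  have h1 := hAh (a := ⟨k, hFΓ hkF⟩)
    ⟨hkF, fun z hz => hkfix z ((hn z hz).trans (by omega))⟩
    ⟨hk, by rintro z rfl; exact hkfix z (by simp)⟩
  have h2 := h1.1 ((γ : T ≃g T) (c.nb r ω))
  change c.localPerm ((γ : T ≃g T) * k * (γ : T ≃g T)⁻¹) ((γ : T ≃g T) (c.nb r ω)) ∈ D at h2
  have h3 : (γ : T ≃g T)⁻¹ ((γ : T ≃g T) (c.nb r ω)) = c.nb r ω :=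
    (γ : T ≃g T).symm_apply_apply _
  rwa [c.localPerm_mul, c.localPerm_mul, c.localPerm_inv, h3, hkfix _ le_rfl, hkτ] at h2

end VertexStabilizers

/-! ### Commensurator of U(D)_x and the localization -/

section Main

variable {V Ω : Type*} {T : SimpleGraph V}

/-- Conjugation by γ is continuous in G(D,F'), where fixators in U(D) are a basis at 1; restricting
to elements of S makes this a statement about neighbourhoods in Γ. -/
theorem eventually_conj_mem_fixIn {c : LegalColoring T Ω} {F D F' : Subgroup (Equiv.Perm Ω)}
    {Γ : Subgroup (T ≃g T)} [TopologicalSpace Γ] [Finite Ω] (hΓ : HasFixBasis c F Γ)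
    (hDF' : D ≤ F') {x : V} {γ : Γ} (hγ : (γ : T ≃g T) ∈ leBoudec c D F') :
    ∀ᶠ k in 𝓝 (1 : Γ), k ∈ fixIn c D Γ {x} → γ * k * γ⁻¹ ∈ fixIn c D Γ {x} := by
  have hΛ := hasFixBasis_leBoudec c D F'
  have h1 := eventually_conj (hΛ.fixIn_mem_nhds (Set.finite_singleton x))
    (⟨(γ : T ≃g T), hγ⟩ : leBoudec c D F')⁻¹
  obtain ⟨A, hA, hAh⟩ := (hΛ _).1 h1
  refine (hΓ _).2 ⟨A, hA, fun k hk hkS => ?_⟩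
  have h2 := hAh (a := ⟨k, burgerMozes_le_leBoudec c hDF' hkS.1⟩) ⟨hkS.1, hk.2⟩
  rw [Set.mem_ofPred_eq, inv_inv] at h2
  exact h2

/-- The localization of a group between `U(F)` and `U(F')` in which `U(F)` is open. -/
theorem isPrimeLocalization_of_hasFixBasis [Finite Ω] (hT : T.IsTree) {c : LegalColoring T Ω}
    {p : ℕ} (hp : p.Prime) {F F' D : Subgroup (Equiv.Perm Ω)} (hDF : D ≤ F) (hFF' : F ≤ F')
    (hpD : IsPGroup p D)
    (hself : ∀ ω, ∀ a ∈ F', (∀ τ ∈ pointStab D ω, a * τ * a⁻¹ ∈ D) → a ∈ D)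
    (hroot : ∀ R : Subgroup (Equiv.Perm Ω), IsPGroup p R → D ≤ R → R ≤ F → R ≤ D)
    (hstab : ∀ (ω : Ω) (R : Subgroup (Equiv.Perm Ω)), IsPGroup p R → pointStab D ω ≤ R →
      R ≤ pointStab F ω → R ≤ pointStab D ω)
    {Γ : Subgroup (T ≃g T)} [TopologicalSpace Γ] [IsTopologicalGroup Γ] (hΓ : HasFixBasis c F Γ)
    (hFΓ : burgerMozes c F ≤ Γ) (hΓF' : Γ ≤ burgerMozes c F') (hΛΓ : leBoudec c D F' ≤ Γ) :
    IsPrimeLocalization p Γ (leBoudec c D F') := by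
  have := hΓ.t2Space
  have := hΓ.nonarchimedeanGroup
  obtain ⟨x⟩ := hT.connected.nonempty
  have hDF' := hDF.trans hFF'
  let S := fixIn c D Γ {x}
  have hS : IsLocalSylow p S := hΓ.isLocalSylow_fixIn hT hp hFΓ hDF hpD hroot hstab x
  have hSc : IsCompact (S : Set Γ) := hS.isCompact hp
  have hcomm : ∀ γ : Γ, γ ∈ Subgroup.Commensurable.commensurator S ↔
      (γ : T ≃g T) ∈ leBoudec c D F' := by
    intro γ
    constructor
    · intro hγ
      refine ⟨hΓ.mem_almostBurgerMozes hT hFΓ hDF hself (hΓF' γ.2) (x := x) ?_, hΓF' γ.2⟩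
      have h1 := (mem_commensurator_iff_eventually hSc _).1 (inv_mem hγ)
      filter_upwards [h1] with k hk hkS
      rw [inv_inv] at hk
      exact hk.2 hkS
    · intro hγ
      rw [mem_commensurator_iff_eventually hSc]
      have h1 := eventually_conj_mem_fixIn hΓ hDF' hγ (x := x)
      have h2 := eventually_conj_mem_fixIn hΓ hDF' (γ := γ⁻¹) (inv_mem hγ) (x := x)
      filter_upwards [eventually_conj h1 γ, h2] with k hk1 hk2
      constructor
      · intro h
        have h3 := hk1 h
        rwa [show γ * (γ⁻¹ * k * γ) * γ⁻¹ = k by group] at h3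
      · intro h
        have h3 := hk2 h
        rwa [inv_inv] at h3
  have hnhds : ∀ s : Set (T ≃g T), (∀ᶠ y : leBoudec c D F' in 𝓝 1, (y : T ≃g T) ∈ s) ↔
      ∀ᶠ y : Γ in 𝓝 1, y ∈ S → (y : T ≃g T) ∈ s := by
    intro s
    constructor
    · intro h
      obtain ⟨A, hA, hAs⟩ := (hasFixBasis_leBoudec c D F' _).1 h
      refine (hΓ _).2 ⟨A, hA, fun k hk hkS => ?_⟩
      exact hAs (a := ⟨k, burgerMozes_le_leBoudec c hDF' hkS.1⟩) ⟨hkS.1, hk.2⟩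
    · intro h
      obtain ⟨A, hA, hAs⟩ := (hΓ _).1 h
      -- Adding x to the fixed set puts the elements into S.
      refine (hasFixBasis_leBoudec c D F' _).2
        ⟨A ∪ {x}, hA.union (Set.finite_singleton x), fun k hk => ?_⟩
      exact hAs (a := ⟨k, hΛΓ k.2⟩)
        ⟨burgerMozes_mono c hDF hk.1, fun z hz => hk.2 z (Or.inl hz)⟩
        ⟨hk.1, fun z hz => hk.2 z (Or.inr hz)⟩
  refine ⟨⟨S, hS, ?_⟩, fun S' hS' => ?_⟩
  · obtain ⟨φ, hφ⟩ := exists_commLocalization_equiv hΛΓ hSc hSc 1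
      (Filter.Eventually.of_forall fun y => by simp) hcomm hnhds
    exact ⟨φ, fun y => by simpa using hφ y⟩
  · obtain ⟨u, hu⟩ := hS.exists_eventually_conj hp hS'
    exact ⟨u, exists_commLocalization_equiv hΛΓ hSc (hS'.isCompact hp) u hu hcomm hnhds⟩

end Main

theorem theorem4p4 {V Ω : Type*} [Finite Ω] (hd : 3 ≤ Nat.card Ω)
    (T : SimpleGraph V) (hT : T.IsTree) (c : LegalColoring T Ω)
    (p : ℕ) (hp : p.Prime)
    (F F' : Subgroup (Equiv.Perm Ω)) (hFF' : F ≤ F') (hF' : F' ≤ orbitHull F)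
    (P : Sylow p F) (Fp : Subgroup (Equiv.Perm Ω)) (hFp : Fp = (P : Subgroup F).map F.subtype)
    (horb : ∀ ω : Ω, MulAction.orbit F ω = MulAction.orbit Fp ω)
    (hnorm : ∀ ω : Ω,
      Subgroup.normalizer (pointStab Fp ω : Set (Equiv.Perm Ω)) ⊓ pointStab F' ω =
        pointStab Fp ω) :
    IsPrimeLocalization p (leBoudec c F F') (leBoudec c Fp F') ∧
    (F' = F → IsPrimeLocalization p (burgerMozes c F) (leBoudec c Fp F)) := by
  have hDF : Fp ≤ F := by
    rw [hFp]
    rintro _ ⟨y, _, rfl⟩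
    exact y.2
  have hpD : IsPGroup p Fp := by
    rw [hFp]
    exact P.isPGroup'.map _
  have hself : ∀ ω, ∀ a ∈ F', (∀ τ ∈ pointStab Fp ω, a * τ * a⁻¹ ∈ Fp) → a ∈ Fp := by
    intro ω a ha h
    exact mem_of_conj_pointStab_le (hDF.trans hFF') (fun b hb => horb ω ▸ hF' hb ω) (hnorm ω) ha h
  obtain ⟨ω₀⟩ : Nonempty Ω := (Nat.card_pos_iff.1 (by omega)).1
  have hroot : ∀ R : Subgroup (Equiv.Perm Ω), IsPGroup p R → Fp ≤ R → R ≤ F → R ≤ Fp := by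
    intro R hR hFR hRF
    -- An element normalizing D in particular conjugates the stabilizer of one point into D; any
    -- point will do.
    exact le_of_normalizer_inf_le hp hR hFR fun r hr h =>
      hself ω₀ r (hFF' (hRF hr)) fun τ hτ => h τ hτ.1
  have hstab : ∀ (ω : Ω) (R : Subgroup (Equiv.Perm Ω)), IsPGroup p R → pointStab Fp ω ≤ R →
      R ≤ pointStab F ω → R ≤ pointStab Fp ω := by
    intro ω R hR hFR hRF
    exact le_of_normalizer_inf_le hp hR hFR fun r hr h =>
      mem_pointStab_of_conj (hnorm ω) ⟨hFF' (hRF hr).1, (hRF hr).2⟩ h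
  refine ⟨isPrimeLocalization_of_hasFixBasis hT hp hDF hFF' hpD hself hroot hstab
    (hasFixBasis_leBoudec c F F') (burgerMozes_le_leBoudec c hFF') inf_le_right
    (leBoudec_mono c hDF), ?_⟩
  rintro rfl
  exact isPrimeLocalization_of_hasFixBasis hT hp hDF le_rfl hpD hself hroot hstab
    (hasFixBasis_burgerMozes c F') le_rfl le_rfl inf_le_right
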